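/- **Setting.** Let $\mu$ be a probability law on $\mathbb R$ of the form $\mu=\alpha\,\delta_0+(1-\alpha)f(x)\,dx$ with $\alpha\in[0,1]$ and $f$ a probability density that is strictly unimodal at $0$ (some version of $f$ is strictly increasing on $(-\infty,0)$ and strictly decreasing on $(0,\infty)$). Let $p(x,\cdot)$ be the law of $x+\xi$ with $\xi\sim\mu$, and let $(X_k)_{k\ge 0}$ be a time-homogeneous Markov chain on $\mathbb R$ with transition kernel $p$ (a random walk with jump law $\mu$) and arbitrary initial law. **Immersion couplings.** An immersion coupling $(X_k,Y_k)_{k\ge l}$ of two Markov chains with kernel $p$ consists of two such chains defined on one probability space and adapted to a common filtration $(\mathcal F_k)_{k\ge l}$ that contains the null events, such that every real martingale for the natural filtration of $X$, and every real martingale for the natural filtration of $Y$, is also a martingale for $(\mathcal F_k)$. For $0\le l<n$, $a>0$ and $\phi:[0,\infty)\to\mathbb R$ let $$\psi^{\phi}_{n,l}(a)=\sup\ \mathbb E\big[\phi(|X_n-Y_n|)\big],$$ the supremum over all immersion couplings of two Markov chains with kernel $p$ such that $|X_l-Y_l|=a$ almost surely. **AMR coupling.** For probability laws $\mu_1,\mu_2$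 on $\mathbb R$ let $\mu_1\wedge\mu_2$ be their meet, $q=1-(\mu_1\wedge\mu_2)(\mathbb R)$, $\nu^*=(1-q)^{-1}(\mu_1\wedge\mu_2)$ if $q<1$, and $\nu_i=q^{-1}(\mu_i-\mu_1\wedge\mu_2)$ if $q>0$. For a probability law $\nu$ and $z\in(0,1)$ put $Q_\nu(z)=\inf\{x:\nu((-\infty,x])>z\}$. The AMR (anti-monotonic rearrangement) coupling of $\mu_1,\mu_2$ is the law of the pair $(V,W)$ built from one Uniform$(0,1)$ variable $U$ by $$V=W=Q_{\nu^*}\big((U-q)/(1-q)\big)\ \text{ if } U\ge q,\qquad V=Q_{\nu_1}(U/q),\quad W=Q_{\nu_2}\big((q-U)/q\big)\ \text{ if } U<q .$$ **Theorem.** Let $l\ge 0$ and $a>0$, and let $(Z_k^{l,a})_{k\ge l}$ be a process on the probability space of $X$ such that $|Z_l^{l,a}-X_l|=a$ almost surely and $(X_k,Z^{l,a}_k)_{k\ge l}$ is a Markov chain in which, for every $k>l$, the conditional law of $(X_k,Z_k^{l,a})$ given the past up to time $k-1$ is the AMR coupling of $p(X_{k-1},\cdot)$ and $p(Z^{l,a}_{k-1},\cdot)$.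 Then for every convex, bounded, continuous, non-increasing $\phi:[0,\infty)\to\mathbb R$ and every $n>l$, $$\psi^{\phi}_{n,l}(a)=\mathbb E\big[\phi(|X_n-Z_n^{l,a}|)\big],$$ and the supremum defining $\psi^{\phi}_{n,l}(a)$ is attained at this value. -/

import Mathlib

open MeasureTheory ProbabilityTheory
open scoped ENNReal

universe u

namespace AMRWalk

noncomputable section

/-! ### Anti-monotonic rearrangement (AMR) coupling of two probability laws on the line -/

/-- The substitute inverse `z ↦ inf {x | ν (-∞, x] > z}` of a distribution function, used in the
Skorokhod representation (only its values for `0 < z < 1` matter). -/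
def quantile (ν : Measure ℝ) (z : ℝ) : ℝ :=
  sInf {x : ℝ | z < ν.real (Set.Iic x)}

/-- `p = 1 - (μ₁ ∧ μ₂)(ℝ)`, where `μ₁ ∧ μ₂` is the meet of the two laws (Mathlib's lattice infimum
of measures). -/
def amrMass (μ₁ μ₂ : Measure ℝ) : ℝ :=
  1 - (μ₁ ⊓ μ₂).real Set.univ

/-- The normalised common part `ν* = (1 - p)⁻¹ (μ₁ ∧ μ₂)`. -/
def amrCommon (μ₁ μ₂ : Measure ℝ) : Measure ℝ :=
  ENNReal.ofReal (1 - amrMass μ₁ μ₂)⁻¹ • (μ₁ ⊓ μ₂)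

/-- The normalised excess `p⁻¹ (μ₁ - μ₁ ∧ μ₂)` of `μ₁` over the meet. The excess of `μ₂` is
`amrExcess μ₂ μ₁`. -/
def amrExcess (μ₁ μ₂ : Measure ℝ) : Measure ℝ :=
  ENNReal.ofReal (amrMass μ₁ μ₂)⁻¹ • (μ₁ - μ₁ ⊓ μ₂)

/-- The pair of random variables `(X, Y)` of the AMR coupling as a function of the
value `v` of a single Uniform(0,1) random variable: equal, with the normalised common part as
law, if `v ≥ p`; and built in an antithetic manner out of the two excess laws if `v < p`. -/
def amrMap (μ₁ μ₂ : Measure ℝ) (v : ℝ) : ℝ × ℝ :=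
  if amrMass μ₁ μ₂ ≤ v then
    (quantile (amrCommon μ₁ μ₂) ((v - amrMass μ₁ μ₂) / (1 - amrMass μ₁ μ₂)),
     quantile (amrCommon μ₁ μ₂) ((v - amrMass μ₁ μ₂) / (1 - amrMass μ₁ μ₂)))
  else
    (quantile (amrExcess μ₁ μ₂) (v / amrMass μ₁ μ₂),
     quantile (amrExcess μ₂ μ₁) ((amrMass μ₁ μ₂ - v) / amrMass μ₁ μ₂))

/-- The joint law of the AMR coupling of `μ₁` and `μ₂`: the image of the uniform law on `(0,1)`. -/
def amrLaw (μ₁ μ₂ : Measure ℝ) : Measure (ℝ × ℝ) :=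
  (volume.restrict (Set.Ioo (0 : ℝ) 1)).map (amrMap μ₁ μ₂)

/-! ### The transition kernels -/

/-- `μ` is a mixture of a Dirac mass at `0` and of a probability density which is strictly unimodal
at `0`. -/
def IsDiracUnimodalMixture (μ : Measure ℝ) : Prop :=
  ∃ α : ℝ, 0 ≤ α ∧ α ≤ 1 ∧ ∃ f : ℝ → ℝ,
    (∀ x, 0 ≤ f x) ∧ StrictMonoOn f (Set.Iio 0) ∧ StrictAntiOn f (Set.Ioi 0) ∧
    ∫⁻ x, ENNReal.ofReal (f x) = 1 ∧
    μ = ENNReal.ofReal α • Measure.dirac 0 +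
      ENNReal.ofReal (1 - α) • volume.withDensity (fun x => ENNReal.ofReal (f x))

/-- The transition kernel of a random walk whose jump law is a mixture of a Dirac mass at `0`
and a strictly unimodal density: from `x` the chain moves to `x + ξ`, where `ξ` has the jump
law. -/
def IsUnimodalWalkKernel (p : Kernel ℝ ℝ) : Prop :=
  ∃ μ : Measure ℝ, IsDiracUnimodalMixture μ ∧ ∀ x, p x = μ.map (fun y => x + y)

/-! ### Markov chains and immersion couplings -/

/-- The process `(W_k)_{k ≥ l}` is a time-homogeneous Markov chain (relative to its own natural
filtration) with transition laws `κ w`: conditionally on `W_l, …, W_k`, the law of `W_{k+1}` is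
`κ W_k`. -/
structure IsMarkovChain {Ω : Type u} [MeasurableSpace Ω] {E : Type*} [TopologicalSpace E]
    [TopologicalSpace.MetrizableSpace E] [SecondCountableTopology E] [MeasurableSpace E]
    [BorelSpace E] {l : ℕ} (κ : E → Measure E) (P : Measure Ω) (W : Set.Ici l → Ω → E) : Prop where
  measurable : ∀ k, Measurable (W k)
  transition : ∀ (k : ℕ) (hk : l ≤ k) (B : Set E), MeasurableSet B →
    P⟦W ⟨k + 1, Nat.le_succ_of_le hk⟩ ⁻¹' B |
        Filtration.natural W (fun j => (measurable j).stronglyMeasurable) ⟨k, hk⟩⟧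
      =ᵐ[P] fun ω => (κ (W ⟨k, hk⟩ ω)).real B

/-- `((X_k, Y_k))_{k ≥ l}` is an immersion coupling for the common filtration `ℱ`: both processes
are adapted to `ℱ`, which contains the null events, and every martingale for the natural filtration
of `X`, or of `Y`, is a martingale for `ℱ`. (Right-continuity of the filtration is
void in discrete time.) -/
structure IsImmersionCoupling {Ω : Type u} [mΩ : MeasurableSpace Ω] {l : ℕ} (P : Measure Ω)
    (ℱ : Filtration (Set.Ici l) mΩ) (X Y : Set.Ici l → Ω → ℝ) : Prop where
  measurable_left : ∀ k, Measurable (X k)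
  measurable_right : ∀ k, Measurable (Y k)
  null_mem : ∀ (k : Set.Ici l) (s : Set Ω), MeasurableSet s → P s = 0 → MeasurableSet[ℱ k] s
  adapted_left : StronglyAdapted ℱ X
  adapted_right : StronglyAdapted ℱ Y
  martingale_left : ∀ M : Set.Ici l → Ω → ℝ,
    Martingale M (Filtration.natural X (fun k => (measurable_left k).stronglyMeasurable)) P →
      Martingale M ℱ P
  martingale_right : ∀ M : Set.Ici l → Ω → ℝ,
    Martingale M (Filtration.natural Y (fun k => (measurable_right k).stronglyMeasurable)) P →
      Martingale M ℱ P

/-- The set of all values `𝔼 φ(|X_n - Y_n|)`, where `((X_k, Y_k))_{k ≥ l}` ranges over all immersion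
couplings, on all probability spaces, of two Markov chains with transition kernel `p` such that
`|X_l - Y_l| = a` almost surely. -/
def immersionPayoffs (p : Kernel ℝ ℝ) (φ : ℝ → ℝ) {n l : ℕ} (hln : l ≤ n) (a : ℝ) : Set ℝ :=
  {r | ∃ (Ω : Type u) (mΩ : MeasurableSpace Ω) (P : Measure Ω) (_ : IsProbabilityMeasure P)
      (ℱ : Filtration (Set.Ici l) mΩ) (X Y : Set.Ici l → Ω → ℝ),
      IsMarkovChain p P X ∧ IsMarkovChain p P Y ∧ IsImmersionCoupling P ℱ X Y ∧
      (∀ᵐ ω ∂P, |X ⟨l, le_refl l⟩ ω - Y ⟨l, le_refl l⟩ ω| = a) ∧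
      r = ∫ ω, φ |X ⟨n, hln⟩ ω - Y ⟨n, hln⟩ ω| ∂P}

/-- `ψ^φ_{n,l}(a)`, the supremum of `𝔼 φ(|X_n - Y_n|)` over immersion couplings with
`|X_l - Y_l| = a`. -/
def psi (p : Kernel ℝ ℝ) (φ : ℝ → ℝ) {n l : ℕ} (hln : l ≤ n) (a : ℝ) : ℝ :=
  sSup (immersionPayoffs.{u} p φ hln a)

end

end AMRWalk

namespace AMRWalk

/-! ### The quantile function and the marginals of the AMR coupling -/

/-! The proof is dynamic programming: one AMR step is optimal for every convex, bounded,
nonincreasing payoff of the distance, and its value, as a function of the starting distance, is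
again such a payoff.

One-step optimality is a duality without gap. For the payoff `(K - d)⁺`, a truncation to an interval
of length `K` gives an upper bound that depends only on the two marginals
(`IsCoupling.payoff_hinge_le`). Translates of the jump law cross once, so the difference of their
distribution functions is unimodal. Take an interval of length `K` lying between its strict and weak
superlevel sets at a level `u₀` (`IsBump.exists_level`). In the AMR coupling, off the common part, a
uniform value below `u₀` puts the two coordinates on opposite sides of this interval, and a value
above `u₀` puts both inside, so truncation to it gives equality (`SingleCrossing.exists_clamp_eq`).
General payoffs are limits of combinations of hinges, and Abel summation transfers the comparison to
them (`integral_le_of_hinge`).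

Stability of the payoff class comes from a second use of the same geometry. By Fubini, the dual
value for `(K - d)⁺` at distance `a` is `K` minus the integral over an interval of length `a` of a
function that is itself the unimodal difference for translates at distance `K`. The largest such
integral is concave and nondecreasing in `a`, with the level as Lagrange multiplier
(`exists_supporting_line`); comparison on hinges then gives `isPayoff_amrStep`.

Immersion means that each walk keeps its kernel relative to the common filtration, so conditioning
at each time yields a coupling of two translates. Induction bounds the expected payoff by an iterate
of `amrStep`, with equality for the AMR chain. That chain is itself an immersion coupling in its
augmented filtration (`martingale_of_isCondLaw`). -/

lemma exists_lt_measureReal_Iic (ν : Measure ℝ) [IsProbabilityMeasure ν] {z : ℝ} (hz : z < 1) :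
    ∃ t, z < ν.real (Set.Iic t) := by
  have h := (tendsto_cdf_atTop ν).eventually (lt_mem_nhds hz)
  obtain ⟨t, ht⟩ := h.exists
  exact ⟨t, by rwa [cdf_eq_real] at ht⟩

lemma bddBelow_lt_measureReal_Iic (ν : Measure ℝ) [IsProbabilityMeasure ν] {z : ℝ} (hz : 0 < z) :
    BddBelow {x : ℝ | z < ν.real (Set.Iic x)} := by
  have h := (tendsto_cdf_atBot ν).eventually (gt_mem_nhds hz)
  obtain ⟨t, ht⟩ := h.exists
  rw [cdf_eq_real] at ht
  refine ⟨t, fun x hx => ?_⟩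
  by_contra! hlt
  have hx' : z < ν.real (Set.Iic x) := hx
  have := measureReal_mono (μ := ν) (Set.Iic_subset_Iic.2 hlt.le)
  linarith

lemma quantile_le (ν : Measure ℝ) [IsProbabilityMeasure ν] {z t : ℝ} (hz : 0 < z)
    (h : z < ν.real (Set.Iic t)) : quantile ν z ≤ t :=
  csInf_le (bddBelow_lt_measureReal_Iic ν hz) h

lemma le_quantile (ν : Measure ℝ) [IsProbabilityMeasure ν] {z s : ℝ} (hz : z < 1)
    (h : ∀ t, z < ν.real (Set.Iic t) → s ≤ t) : s ≤ quantile ν z :=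
  le_csInf (exists_lt_measureReal_Iic ν hz) h

/-- Right-continuity of the distribution function passes the bound from all points to the right of
`t` to `t` itself; at `t` only the weak inequality survives. -/
lemma le_measureReal_of_quantile_le (ν : Measure ℝ) [IsProbabilityMeasure ν] {z t : ℝ}
    (hz1 : z < 1) (h : quantile ν z ≤ t) : z ≤ ν.real (Set.Iic t) := by
  have hgt : ∀ x, t < x → z ≤ cdf ν x := fun x hx => by
    obtain ⟨y, hy, hyx⟩ := exists_lt_of_csInf_lt (exists_lt_measureReal_Iic ν hz1)
      (lt_of_le_of_lt h hx)
    rw [cdf_eq_real]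
    exact le_trans (le_of_lt hy) (measureReal_mono (Set.Iic_subset_Iic.2 hyx.le))
  rw [← cdf_eq_real]
  have hc : Filter.Tendsto (cdf ν) (nhdsWithin t (Set.Ioi t)) (nhds (cdf ν t)) :=
    ((cdf ν).right_continuous t).tendsto.mono_left (nhdsWithin_mono _ Set.Ioi_subset_Ici_self)
  exact ge_of_tendsto hc (by filter_upwards [self_mem_nhdsWithin] with x hx using hgt x hx)

lemma monotoneOn_quantile (ν : Measure ℝ) [IsProbabilityMeasure ν] :
    MonotoneOn (quantile ν) (Set.Ioo 0 1) := by
  intro z hz z' hz' hzz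
  exact csInf_le_csInf (bddBelow_lt_measureReal_Iic ν hz.1) (exists_lt_measureReal_Iic ν hz'.2)
    fun x hx => lt_of_le_of_lt hzz hx

lemma aemeasurable_quantile (ν : Measure ℝ) [IsProbabilityMeasure ν] :
    AEMeasurable (quantile ν) (volume.restrict (Set.Ioo (0 : ℝ) 1)) :=
  aemeasurable_restrict_of_monotoneOn measurableSet_Ioo (monotoneOn_quantile ν)

/-- Skorokhod representation: the quantile function maps the uniform law to `ν`. -/
lemma map_quantile (ν : Measure ℝ) [IsProbabilityMeasure ν] :
    (volume.restrict (Set.Ioo (0 : ℝ) 1)).map (quantile ν) = ν := by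
  refine Measure.ext_of_Iic _ _ fun t => ?_
  rw [Measure.map_apply_of_aemeasurable (aemeasurable_quantile ν) measurableSet_Iic]
  have h1 : ν.real (Set.Iic t) ≤ 1 := measureReal_le_one
  -- The preimage of `(-∞, t]` is squeezed between `(0, F(t))` and `(0, F(t)]`, which have the same
  -- length, so the boundary value need not be decided.
  have key : ∀ s : Set ℝ, (∀ z ∈ Set.Ioo (0 : ℝ) 1, z < ν.real (Set.Iic t) → z ∈ s) →
      (∀ z ∈ Set.Ioo (0 : ℝ) 1, z ∈ s → z ≤ ν.real (Set.Iic t)) →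
      volume.restrict (Set.Ioo (0 : ℝ) 1) s = ν (Set.Iic t) := by
    intro s hs1 hs2
    rw [Measure.restrict_apply' measurableSet_Ioo, ← ofReal_measureReal (μ := ν)]
    apply le_antisymm
    · calc volume (s ∩ Set.Ioo 0 1) ≤ volume (Set.Ioc 0 (ν.real (Set.Iic t))) :=
            measure_mono fun z hz => ⟨hz.2.1, hs2 z hz.2 hz.1⟩
        _ = _ := by simp
    · calc ENNReal.ofReal (ν.real (Set.Iic t)) = volume (Set.Ioo 0 (ν.real (Set.Iic t))) := by simp
        _ ≤ _ := measure_mono fun z hz => by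
            have hz1 : z ∈ Set.Ioo (0 : ℝ) 1 := ⟨hz.1, lt_of_lt_of_le hz.2 h1⟩
            exact ⟨hs1 z hz1 hz.2, hz1⟩
  exact key _ (fun z hz h => quantile_le ν hz.1 h)
    (fun z hz h => le_measureReal_of_quantile_le ν hz.2 h)

lemma map_volume_affine (b : ℝ) {c : ℝ} (hc : c ≠ 0) :
    (volume : Measure ℝ).map (fun v => (v - b) / c) = ENNReal.ofReal |c| • volume := by
  have h1 : (fun v : ℝ => (v - b) / c) = (fun v => v * c⁻¹) ∘ (fun v => v - b) := by
    ext v; simp [div_eq_mul_inv]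
  rw [h1, ← Measure.map_map (by fun_prop) (by fun_prop),
    (measurePreserving_sub_right volume b).map_eq, Real.map_volume_mul_right (inv_ne_zero hc),
    inv_inv]

lemma map_restrict_affine (b : ℝ) {c : ℝ} (hc : c ≠ 0) {s t : Set ℝ} (ht : MeasurableSet t)
    (h : (fun v => (v - b) / c) ⁻¹' t = s) :
    (volume.restrict s).map (fun v => (v - b) / c) = ENNReal.ofReal |c| • volume.restrict t := by
  rw [← h, ← Measure.restrict_map (by fun_prop) ht, map_volume_affine b hc, Measure.restrict_smul]

/-- Law of an affine function of the uniform variable composed with a quantile function. -/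
lemma map_quantile_affine (ν : Measure ℝ) [IsProbabilityMeasure ν] (b : ℝ) {c : ℝ} (hc : c ≠ 0)
    {s : Set ℝ} (h : (fun v => (v - b) / c) ⁻¹' (Set.Ioo 0 1) = s) :
    AEMeasurable (fun v => quantile ν ((v - b) / c)) (volume.restrict s) ∧
    (volume.restrict s).map (fun v => quantile ν ((v - b) / c)) = ENNReal.ofReal |c| • ν := by
  have hm := map_restrict_affine b hc (s := s) measurableSet_Ioo h
  have hq : AEMeasurable (quantile ν) ((volume.restrict s).map (fun v => (v - b) / c)) := by
    rw [hm]; exact (aemeasurable_quantile ν).smul_measure _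
  have hf : Measurable (fun v : ℝ => (v - b) / c) := by fun_prop
  refine ⟨hq.comp_measurable hf, ?_⟩
  change (volume.restrict s).map (quantile ν ∘ fun v => (v - b) / c) = _
  rw [← AEMeasurable.map_map_of_aemeasurable hq hf.aemeasurable, hm, Measure.map_smul,
    map_quantile]

section Marginals

variable (μ₁ μ₂ : Measure ℝ) [IsProbabilityMeasure μ₁] [IsProbabilityMeasure μ₂]

instance : IsFiniteMeasure (μ₁ ⊓ μ₂) :=
  isFiniteMeasure_of_le μ₁ inf_le_left

omit [IsProbabilityMeasure μ₂] in
lemma excess_add_inf : (μ₁ - μ₁ ⊓ μ₂) + μ₁ ⊓ μ₂ = μ₁ :=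
  Measure.sub_add_cancel_of_le inf_le_left

omit [IsProbabilityMeasure μ₁] [IsProbabilityMeasure μ₂] in
lemma amrMass_comm : amrMass μ₁ μ₂ = amrMass μ₂ μ₁ := by
  rw [amrMass, amrMass, inf_comm]

omit [IsProbabilityMeasure μ₁] [IsProbabilityMeasure μ₂] in
lemma amrCommon_comm : amrCommon μ₁ μ₂ = amrCommon μ₂ μ₁ := by
  rw [amrCommon, amrCommon, inf_comm, amrMass_comm]

omit [IsProbabilityMeasure μ₂] in
lemma measureReal_excess (s : Set ℝ) :
    (μ₁ - μ₁ ⊓ μ₂).real s = μ₁.real s - (μ₁ ⊓ μ₂).real s := by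
  have : IsFiniteMeasure (μ₁ - μ₁ ⊓ μ₂) := isFiniteMeasure_of_le μ₁ Measure.sub_le
  have h : ((μ₁ - μ₁ ⊓ μ₂) + μ₁ ⊓ μ₂).real s = μ₁.real s := by rw [excess_add_inf]
  rw [measureReal_add_apply] at h
  linarith

lemma measureReal_excess_univ : (μ₁ - μ₁ ⊓ μ₂).real Set.univ = amrMass μ₁ μ₂ := by
  rw [measureReal_excess, amrMass, probReal_univ]

lemma amrMass_nonneg : 0 ≤ amrMass μ₁ μ₂ := by
  rw [← measureReal_excess_univ]; exact measureReal_nonneg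

omit [IsProbabilityMeasure μ₁] [IsProbabilityMeasure μ₂] in
lemma amrMass_le_one : amrMass μ₁ μ₂ ≤ 1 := by
  rw [amrMass]; linarith [measureReal_nonneg (μ := μ₁ ⊓ μ₂) (s := Set.univ)]

lemma measureReal_amrExcess (s : Set ℝ) :
    (amrExcess μ₁ μ₂).real s = (amrMass μ₁ μ₂)⁻¹ * (μ₁ - μ₁ ⊓ μ₂).real s := by
  rw [amrExcess, measureReal_ennreal_smul_apply,
    ENNReal.toReal_ofReal (inv_nonneg.2 (amrMass_nonneg _ _))]

lemma isProbabilityMeasure_amrExcess (h : amrMass μ₁ μ₂ ≠ 0) :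
    IsProbabilityMeasure (amrExcess μ₁ μ₂) := by
  have : IsFiniteMeasure (μ₁ - μ₁ ⊓ μ₂) := isFiniteMeasure_of_le μ₁ Measure.sub_le
  have : IsFiniteMeasure (amrExcess μ₁ μ₂) := by
    rw [amrExcess]; exact Measure.smul_finite _ ENNReal.ofReal_ne_top
  rw [isProbabilityMeasure_iff_real, measureReal_amrExcess, measureReal_excess_univ,
    inv_mul_cancel₀ h]

omit [IsProbabilityMeasure μ₂] in
lemma isProbabilityMeasure_amrCommon (h : amrMass μ₁ μ₂ ≠ 1) :
    IsProbabilityMeasure (amrCommon μ₁ μ₂) := by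
  have : IsFiniteMeasure (amrCommon μ₁ μ₂) := by
    rw [amrCommon]; exact Measure.smul_finite _ ENNReal.ofReal_ne_top
  have h1 : 0 ≤ 1 - amrMass μ₁ μ₂ := by linarith [amrMass_le_one μ₁ μ₂]
  rw [isProbabilityMeasure_iff_real, amrCommon, measureReal_ennreal_smul_apply,
    ENNReal.toReal_ofReal (inv_nonneg.2 h1)]
  have : (μ₁ ⊓ μ₂).real Set.univ = 1 - amrMass μ₁ μ₂ := by rw [amrMass]; ring
  rw [this, inv_mul_cancel₀ (fun h0 => h (by linarith))]

lemma smul_amrExcess : ENNReal.ofReal (amrMass μ₁ μ₂) • amrExcess μ₁ μ₂ = μ₁ - μ₁ ⊓ μ₂ := by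
  have : IsFiniteMeasure (μ₁ - μ₁ ⊓ μ₂) := isFiniteMeasure_of_le μ₁ Measure.sub_le
  rcases eq_or_ne (amrMass μ₁ μ₂) 0 with h | h
  · have h0 := measureReal_excess_univ μ₁ μ₂
    rw [h, measureReal_eq_zero_iff, Measure.measure_univ_eq_zero] at h0
    rw [h, h0]; simp
  · rw [amrExcess, smul_smul, ← ENNReal.ofReal_mul (amrMass_nonneg _ _), mul_inv_cancel₀ h]
    simp

omit [IsProbabilityMeasure μ₂] in
lemma smul_amrCommon :
    ENNReal.ofReal (1 - amrMass μ₁ μ₂) • amrCommon μ₁ μ₂ = μ₁ ⊓ μ₂ := by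
  have hm : (μ₁ ⊓ μ₂).real Set.univ = 1 - amrMass μ₁ μ₂ := by rw [amrMass]; ring
  rcases eq_or_ne (1 - amrMass μ₁ μ₂) 0 with h | h
  · rw [h, measureReal_eq_zero_iff, Measure.measure_univ_eq_zero] at hm
    rw [h, hm]; simp
  · rw [amrCommon, smul_smul, ← ENNReal.ofReal_mul (by linarith [amrMass_le_one μ₁ μ₂]),
      mul_inv_cancel₀ h]
    simp

lemma restrict_Ioo_eq_add {q : ℝ} (h0 : 0 ≤ q) (h1 : q ≤ 1) :
    (volume.restrict (Set.Ioo (0 : ℝ) 1)) =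
      volume.restrict (Set.Ioo 0 q) + volume.restrict (Set.Ioo q 1) := by
  have hI : ∀ a b : ℝ, (volume.restrict (Set.Ioo a b)) = volume.restrict (Set.Ioc a b) :=
    fun a b => Measure.restrict_congr_set Ioo_ae_eq_Ioc
  rw [hI, hI, hI, ← Measure.restrict_union (Set.Ioc_disjoint_Ioc_of_le le_rfl) measurableSet_Ioc,
    Set.Ioc_union_Ioc_eq_Ioc h0 h1]

omit [IsProbabilityMeasure μ₁] [IsProbabilityMeasure μ₂] in
lemma amrMap_of_lt {v : ℝ} (h : v < amrMass μ₁ μ₂) : amrMap μ₁ μ₂ v =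
    (quantile (amrExcess μ₁ μ₂) (v / amrMass μ₁ μ₂),
      quantile (amrExcess μ₂ μ₁) ((amrMass μ₁ μ₂ - v) / amrMass μ₁ μ₂)) :=
  if_neg (not_le.2 h)

omit [IsProbabilityMeasure μ₁] [IsProbabilityMeasure μ₂] in
lemma amrMap_of_le {v : ℝ} (h : amrMass μ₁ μ₂ ≤ v) : amrMap μ₁ μ₂ v =
    (quantile (amrCommon μ₁ μ₂) ((v - amrMass μ₁ μ₂) / (1 - amrMass μ₁ μ₂)),
      quantile (amrCommon μ₁ μ₂) ((v - amrMass μ₁ μ₂) / (1 - amrMass μ₁ μ₂))) :=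
  if_pos h

/-- For `v` uniform on `(0, q)`, both `v / q` and `(q - v) / q` are uniform on `(0, 1)`; the
antithetic one is the affine map with divisor `-q`. Unnormalised images make the degenerate case `q
= 0` trivial. -/
lemma map_amrMap_low :
    AEMeasurable (amrMap μ₁ μ₂) (volume.restrict (Set.Ioo 0 (amrMass μ₁ μ₂))) ∧
    (volume.restrict (Set.Ioo 0 (amrMass μ₁ μ₂))).map (fun v => (amrMap μ₁ μ₂ v).1)
      = μ₁ - μ₁ ⊓ μ₂ ∧
    (volume.restrict (Set.Ioo 0 (amrMass μ₁ μ₂))).map (fun v => (amrMap μ₁ μ₂ v).2)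
      = μ₂ - μ₂ ⊓ μ₁ := by
  rw [← smul_amrExcess μ₁ μ₂, ← smul_amrExcess μ₂ μ₁, ← amrMass_comm μ₁ μ₂]
  have hcomm := amrMass_comm μ₁ μ₂
  set q := amrMass μ₁ μ₂ with hq
  have hmap : amrMap μ₁ μ₂ =ᵐ[volume.restrict (Set.Ioo 0 q)] fun v =>
      (quantile (amrExcess μ₁ μ₂) ((v - 0) / q), quantile (amrExcess μ₂ μ₁) ((v - q) / (-q))) := by
    refine (ae_restrict_iff' measurableSet_Ioo).2 (Filter.Eventually.of_forall fun v hv => ?_)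
    simp only [amrMap_of_lt μ₁ μ₂ hv.2, ← hq, sub_zero, div_neg, ← neg_div, neg_sub]
  rcases eq_or_ne q 0 with h | h
  · rw [h]; simp
  have hpos : 0 < q := lt_of_le_of_ne (amrMass_nonneg _ _) (Ne.symm h)
  have := isProbabilityMeasure_amrExcess μ₁ μ₂ h
  have := isProbabilityMeasure_amrExcess μ₂ μ₁ (hcomm ▸ h)
  have h1 := map_quantile_affine (amrExcess μ₁ μ₂) 0 h (s := Set.Ioo 0 q) (by
    ext v
    simp only [Set.mem_preimage, Set.mem_Ioo, sub_zero, div_pos_iff_of_pos_right hpos,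
      div_lt_one hpos])
  have h2 := map_quantile_affine (amrExcess μ₂ μ₁) q (neg_ne_zero.2 h) (s := Set.Ioo 0 q) (by
    ext v
    have : (v - q) / (-q) = (q - v) / q := by rw [div_neg, ← neg_div, neg_sub]
    simp only [Set.mem_preimage, Set.mem_Ioo, this, div_pos_iff_of_pos_right hpos,
      div_lt_one hpos]
    constructor <;> rintro ⟨h1, h2⟩ <;> constructor <;> linarith)
  rw [abs_neg] at h2
  rw [abs_of_pos hpos] at h1 h2
  refine ⟨(h1.1.prodMk h2.1).congr hmap.symm, ?_, ?_⟩
  · rw [← h1.2]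
    exact Measure.map_congr (hmap.mono fun v hv => by simp [hv])
  · rw [← h2.2]
    exact Measure.map_congr (hmap.mono fun v hv => by simp [hv])

lemma map_amrMap_high :
    AEMeasurable (amrMap μ₁ μ₂) (volume.restrict (Set.Ioo (amrMass μ₁ μ₂) 1)) ∧
    (volume.restrict (Set.Ioo (amrMass μ₁ μ₂) 1)).map (fun v => (amrMap μ₁ μ₂ v).1)
      = μ₁ ⊓ μ₂ ∧
    (volume.restrict (Set.Ioo (amrMass μ₁ μ₂) 1)).map (fun v => (amrMap μ₁ μ₂ v).2)
      = μ₁ ⊓ μ₂ := by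
  rw [← smul_amrCommon μ₁ μ₂]
  set q := amrMass μ₁ μ₂ with hq
  have hmap : amrMap μ₁ μ₂ =ᵐ[volume.restrict (Set.Ioo q 1)] fun v =>
      (quantile (amrCommon μ₁ μ₂) ((v - q) / (1 - q)),
        quantile (amrCommon μ₁ μ₂) ((v - q) / (1 - q))) := by
    refine (ae_restrict_iff' measurableSet_Ioo).2 (Filter.Eventually.of_forall fun v hv => ?_)
    rw [amrMap_of_le μ₁ μ₂ hv.1.le]
  rcases eq_or_ne q 1 with h | h
  · rw [h]; simp
  have hpos : 0 < 1 - q := sub_pos.2 (lt_of_le_of_ne (amrMass_le_one _ _) h)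
  have := isProbabilityMeasure_amrCommon μ₁ μ₂ h
  have h1 := map_quantile_affine (amrCommon μ₁ μ₂) q hpos.ne' (s := Set.Ioo q 1) (by
    ext v
    simp only [Set.mem_preimage, Set.mem_Ioo, div_pos_iff_of_pos_right hpos,
      div_lt_one hpos]
    constructor <;> rintro ⟨h1, h2⟩ <;> constructor <;> linarith)
  rw [abs_of_pos hpos] at h1
  refine ⟨(h1.1.prodMk h1.1).congr hmap.symm, ?_, ?_⟩ <;>
  · rw [← h1.2]
    exact Measure.map_congr (hmap.mono fun v hv => by simp [hv])

lemma aemeasurable_amrMap :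
    AEMeasurable (amrMap μ₁ μ₂) (volume.restrict (Set.Ioo (0 : ℝ) 1)) := by
  rw [restrict_Ioo_eq_add (amrMass_nonneg μ₁ μ₂) (amrMass_le_one μ₁ μ₂)]
  exact aemeasurable_add_measure_iff.2 ⟨(map_amrMap_low μ₁ μ₂).1, (map_amrMap_high μ₁ μ₂).1⟩

instance : IsProbabilityMeasure (amrLaw μ₁ μ₂) := by
  have : IsProbabilityMeasure (volume.restrict (Set.Ioo (0 : ℝ) 1)) := ⟨by simp⟩
  exact Measure.isProbabilityMeasure_map (aemeasurable_amrMap μ₁ μ₂)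

lemma amrLaw_map_fst : (amrLaw μ₁ μ₂).map Prod.fst = μ₁ := by
  rw [amrLaw, AEMeasurable.map_map_of_aemeasurable measurable_fst.aemeasurable
    (aemeasurable_amrMap μ₁ μ₂), restrict_Ioo_eq_add (amrMass_nonneg μ₁ μ₂) (amrMass_le_one μ₁ μ₂),
    AEMeasurable.map_add₀]
  · change Measure.map (fun v => (amrMap μ₁ μ₂ v).1) _ + Measure.map (fun v => (amrMap μ₁ μ₂ v).1) _
      = μ₁
    rw [(map_amrMap_low μ₁ μ₂).2.1, (map_amrMap_high μ₁ μ₂).2.1, excess_add_inf]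
  · exact measurable_fst.comp_aemeasurable (map_amrMap_low μ₁ μ₂).1
  · exact measurable_fst.comp_aemeasurable (map_amrMap_high μ₁ μ₂).1

lemma amrLaw_map_snd : (amrLaw μ₁ μ₂).map Prod.snd = μ₂ := by
  rw [amrLaw, AEMeasurable.map_map_of_aemeasurable measurable_snd.aemeasurable
    (aemeasurable_amrMap μ₁ μ₂), restrict_Ioo_eq_add (amrMass_nonneg μ₁ μ₂) (amrMass_le_one μ₁ μ₂),
    AEMeasurable.map_add₀]
  · change Measure.map (fun v => (amrMap μ₁ μ₂ v).2) _ + Measure.map (fun v => (amrMap μ₁ μ₂ v).2) _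
      = μ₂
    rw [(map_amrMap_low μ₁ μ₂).2.2, (map_amrMap_high μ₁ μ₂).2.2, inf_comm μ₁ μ₂, excess_add_inf]
  · exact measurable_snd.comp_aemeasurable (map_amrMap_low μ₁ μ₂).1
  · exact measurable_snd.comp_aemeasurable (map_amrMap_high μ₁ μ₂).1

/-- Exchanging the two laws exchanges the two coordinates of the AMR coupling. -/
lemma amrLaw_swap : amrLaw μ₂ μ₁ = (amrLaw μ₁ μ₂).map Prod.swap := by
  have hcomm := amrMass_comm μ₁ μ₂
  have hccomm := amrCommon_comm μ₁ μ₂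
  have hq0 := amrMass_nonneg μ₁ μ₂
  have hq1 := amrMass_le_one μ₁ μ₂
  have hlow := (map_amrMap_low μ₁ μ₂).1
  have hhigh := (map_amrMap_high μ₁ μ₂).1
  rw [amrLaw, amrLaw, AEMeasurable.map_map_of_aemeasurable measurable_swap.aemeasurable
    (aemeasurable_amrMap μ₁ μ₂)]
  have hsplit := restrict_Ioo_eq_add hq0 hq1
  -- The reflection `v ↦ q - v` preserves length on `(0, q)` and exchanges the two antithetic
  -- arguments. It is written as a division by `-1` to fit `map_restrict_affine`.
  have hrefl : (volume.restrict (Set.Ioo 0 (amrMass μ₁ μ₂))).map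
      (fun v => (v - amrMass μ₁ μ₂) / (-1)) = volume.restrict (Set.Ioo 0 (amrMass μ₁ μ₂)) := by
    rw [map_restrict_affine (amrMass μ₁ μ₂) (by norm_num : (-1 : ℝ) ≠ 0) measurableSet_Ioo
      (s := Set.Ioo 0 (amrMass μ₁ μ₂)) (t := Set.Ioo 0 (amrMass μ₁ μ₂))]
    · simp
    · ext v
      simp only [Set.mem_preimage, Set.mem_Ioo]
      constructor <;> rintro ⟨h1, h2⟩ <;> constructor <;> linarith
  have hlow2 := (map_amrMap_low μ₂ μ₁).1
  have hhigh2 := (map_amrMap_high μ₂ μ₁).1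
  rw [← hcomm] at hlow2 hhigh2
  set q := amrMass μ₁ μ₂ with hq
  have hr : Measurable fun v : ℝ => (v - q) / (-1) := by fun_prop
  rw [hsplit, AEMeasurable.map_add₀ (measurable_swap.comp_aemeasurable hlow)
    (measurable_swap.comp_aemeasurable hhigh), AEMeasurable.map_add₀ hlow2 hhigh2]
  congr 1
  · conv_rhs => rw [← hrefl]
    rw [AEMeasurable.map_map_of_aemeasurable _ hr.aemeasurable]
    · refine Measure.map_congr ?_
      refine (ae_restrict_iff' measurableSet_Ioo).2 (Filter.Eventually.of_forall fun v hv => ?_)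
      have e : (v - q) / (-1) = q - v := by ring
      simp only [Function.comp_apply, e]
      rw [amrMap_of_lt μ₂ μ₁ (hcomm ▸ hv.2), amrMap_of_lt μ₁ μ₂ (by rw [← hq]; linarith [hv.1]),
        ← hcomm, ← hq, sub_sub_cancel]
      rfl
    · rw [hrefl]; exact measurable_swap.comp_aemeasurable hlow
  · refine Measure.map_congr ?_
    refine (ae_restrict_iff' measurableSet_Ioo).2 (Filter.Eventually.of_forall fun v hv => ?_)
    simp only [Function.comp_apply]
    rw [amrMap_of_le μ₂ μ₁ (hcomm ▸ hv.1.le), amrMap_of_le μ₁ μ₂ hv.1.le, ← hcomm, ← hccomm]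
    rfl

end Marginals

/-! ### Level intervals of unimodal functions -/

/-- A function is unimodal along a lower set `A` if it is nondecreasing on `A` and nonincreasing
off `A`; it is required here to be nonnegative, bounded, and to vanish at infinity. -/
structure IsBump (h : ℝ → ℝ) (A : Set ℝ) : Prop where
  isLowerSet : IsLowerSet A
  monotoneOn : MonotoneOn h A
  antitoneOn : AntitoneOn h Aᶜ
  nonneg : ∀ t, 0 ≤ h t
  le_one : ∀ t, h t ≤ 1
  atTop : Filter.Tendsto h Filter.atTop (nhds 0)
  atBot : Filter.Tendsto h Filter.atBot (nhds 0)

/-- Superlevel sets of a unimodal function are intervals, so a point outside one has all of it on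
one side. -/
lemma IsBump.le_left_or_right {h : ℝ → ℝ} {A : Set ℝ} (hh : IsBump h A) {t u : ℝ} (ht : h t ≤ u) :
    (∀ x, x ≤ t → h x ≤ u) ∨ (∀ x, t ≤ x → h x ≤ u) := by
  by_cases hA : t ∈ A
  · exact Or.inl fun x hx => (hh.monotoneOn (hh.isLowerSet hx hA) hA hx).trans ht
  · exact Or.inr fun x hx => (hh.antitoneOn hA (fun h' => hA (hh.isLowerSet hx h')) hx).trans ht

/-- For every length `L` there is an interval of length `L` squeezed between the strict and the
weak superlevel set at some level. -/
lemma IsBump.exists_level {h : ℝ → ℝ} {A : Set ℝ} (hh : IsBump h A) (L : ℝ) :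
    ∃ s u₀ : ℝ, 0 ≤ u₀ ∧ (∀ t, u₀ < h t → t ∈ Set.Icc s (s + L)) ∧
      ∀ t ∈ Set.Ioo s (s + L), u₀ ≤ h t := by
  -- The level is the least one whose strict superlevel set has diameter at most `L`. Level `1`
  -- qualifies because its strict superlevel set is empty.
  set U : Set ℝ := {u | 0 ≤ u ∧ ∀ t t', u < h t → u < h t' → t' - t ≤ L} with hU
  have hUne : U.Nonempty := ⟨1, zero_le_one, fun t _ ht => absurd (hh.le_one t) (not_le.2 ht)⟩
  have hUbdd : BddBelow U := ⟨0, fun u hu => hu.1⟩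
  set u₀ := sInf U with hu₀
  have hu₀0 : 0 ≤ u₀ := le_csInf hUne fun u hu => hu.1
  have hdiam : ∀ t t', u₀ < h t → u₀ < h t' → t' - t ≤ L := by
    intro t t' ht ht'
    obtain ⟨u, hu, hlt⟩ := exists_lt_of_csInf_lt hUne (lt_min ht ht')
    exact hu.2 t t' (hlt.trans_le (min_le_left _ _)) (hlt.trans_le (min_le_right _ _))
  have hwide : ∀ u, 0 < u → u < u₀ → ∃ t t', u < h t ∧ u < h t' ∧ L < t' - t := by
    intro u hu hlt
    by_contra! hcon
    exact absurd (csInf_le hUbdd ⟨hu.le, hcon⟩) (not_le.2 hlt)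
  -- `S` collects the lower constraints on the left end `s`, and `T` the upper ones: the superlevel
  -- set at `u₀` must fit in `[s, s + L]`, while those at levels `u < u₀` must reach both ends. Any
  -- point separating `S` from `T` will do.
  set S : Set ℝ := {x | ∃ u, 0 < u ∧ u < u₀ ∧ ∀ t, u < h t → x ≤ t} ∪ {x | u₀ < h (x + L)} with hS
  set T : Set ℝ := {y | ∃ u, 0 < u ∧ u < u₀ ∧ ∀ t, u < h t → t ≤ y + L} ∪ {y | u₀ < h y} with hT
  have hST : ∀ x ∈ S, ∀ y ∈ T, x ≤ y := by
    rintro x (⟨u, hu0, hu, hx⟩ | hx) y (⟨v, hv0, hv, hy⟩ | hy)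
    · obtain ⟨t, t', ht, ht', hlt⟩ := hwide (max u v) (lt_max_of_lt_left hu0) (max_lt hu hv)
      have h1 := hx t ((le_max_left _ _).trans_lt ht)
      have h2 := hy t' ((le_max_right _ _).trans_lt ht')
      linarith
    · exact hx y (hu.trans hy)
    · linarith [hy _ (hv.trans hx)]
    · linarith [hdiam _ _ hy hx]
  obtain ⟨s, hsS, hsT⟩ : ∃ s, (∀ x ∈ S, x ≤ s) ∧ ∀ y ∈ T, s ≤ y := by
    -- Decay at infinity bounds the superlevel set at the positive level `u₀ / 2`, which rules out
    -- the cases where no finite separating point exists. If both sets are empty, any `s` works.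
    rcases S.eq_empty_or_nonempty with hSe | hSne
    · rcases T.eq_empty_or_nonempty with hTe | hTne
      · exact ⟨0, by simp [hSe], by simp [hTe]⟩
      · by_cases hTb : BddBelow T
        · exact ⟨sInf T, by simp [hSe], fun y hy => csInf_le hTb hy⟩
        · exfalso
          obtain ⟨y, hy⟩ := hTne
          have hcase : u₀ < h y ∨ 0 < u₀ := by
            rcases hy with ⟨u, h1, h2, -⟩ | hy
            · exact Or.inr (h1.trans h2)
            · exact Or.inl hy
          rcases hcase with hy | hpos
          · have : y - L ∈ S := Or.inr (by simpa using hy)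
            rw [hSe] at this; exact this
          · have hev := hh.atBot.eventually (gt_mem_nhds (half_pos hpos))
            obtain ⟨b, hb⟩ := Filter.eventually_atBot.1 hev
            have : b ∈ S := Or.inl ⟨u₀ / 2, half_pos hpos, half_lt_self hpos, fun t ht => by
              by_contra! hlt
              exact absurd (hb t hlt.le) (not_lt.2 ht.le)⟩
            rw [hSe] at this; exact this
    · by_cases hSb : BddAbove S
      · exact ⟨sSup S, fun x hx => le_csSup hSb hx,
          fun y hy => csSup_le hSne fun x hx => hST x hx y hy⟩
      · exfalso
        obtain ⟨x, hx⟩ := hSne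
        have hcase : u₀ < h (x + L) ∨ 0 < u₀ := by
          rcases hx with ⟨u, h1, h2, -⟩ | hx
          · exact Or.inr (h1.trans h2)
          · exact Or.inl hx
        rcases hcase with hx | hpos
        · exact hSb ⟨x + L, fun z hz => hST z hz _ (Or.inr hx)⟩
        · have hev := hh.atTop.eventually (gt_mem_nhds (half_pos hpos))
          obtain ⟨b, hb⟩ := Filter.eventually_atTop.1 hev
          refine hSb ⟨b - L, fun z hz => hST z hz _
            (Or.inl ⟨u₀ / 2, half_pos hpos, half_lt_self hpos, fun t ht => ?_⟩)⟩
          by_contra! hlt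
          exact absurd (hb t (by linarith)) (not_lt.2 ht.le)
  refine ⟨s, u₀, hu₀0, fun t ht => ⟨hsT t (Or.inr ht), ?_⟩, fun t ht => ?_⟩
  · have := hsS (t - L) (Or.inr (by simpa using ht))
    linarith
  · rcases hu₀0.eq_or_lt with h0 | hpos
    · rw [← h0]; exact hh.nonneg t
    refine le_of_forall_lt_imp_le_of_dense fun u hu => ?_
    rcases le_or_gt u 0 with hu0 | hu0
    · exact hu0.trans (hh.nonneg t)
    by_contra! hlt
    rcases hh.le_left_or_right hlt.le with hl | hr
    · have := hsS t (Or.inl ⟨u, hu0, hu, fun x hx => by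
        by_contra! hxt
        exact absurd (hl x hxt.le) (not_le.2 hx)⟩)
      linarith [ht.1]
    · have := hsT (t - L) (Or.inl ⟨u, hu0, hu, fun x hx => by
        by_contra! hxt
        exact absurd (hr x (by linarith)) (not_le.2 hx)⟩)
      linarith [ht.2]

/-! ### Pairs of laws with a single crossing -/

/-- `μ₁` dominates `μ₂` on the lower set `A`, and is dominated by `μ₂` off `A`. -/
structure SingleCrossing (μ₁ μ₂ : Measure ℝ) (A : Set ℝ) : Prop where
  isLowerSet : IsLowerSet A
  le_on : μ₂.restrict A ≤ μ₁.restrict A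
  le_off : μ₁.restrict Aᶜ ≤ μ₂.restrict Aᶜ

namespace SingleCrossing

variable {μ₁ μ₂ : Measure ℝ} [IsProbabilityMeasure μ₁] [IsProbabilityMeasure μ₂] {A : Set ℝ}

omit [IsProbabilityMeasure μ₁] [IsProbabilityMeasure μ₂] in
lemma measurableSet (hc : SingleCrossing μ₁ μ₂ A) : MeasurableSet A :=
  hc.isLowerSet.ordConnected.measurableSet

omit [IsProbabilityMeasure μ₁] [IsProbabilityMeasure μ₂] in
lemma inf_eq (hc : SingleCrossing μ₁ μ₂ A) : μ₁ ⊓ μ₂ = μ₂.restrict A + μ₁.restrict Aᶜ := by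
  have hA := hc.measurableSet
  apply le_antisymm
  · rw [← Measure.restrict_add_restrict_compl (μ := μ₁ ⊓ μ₂) hA]
    exact add_le_add (Measure.restrict_mono le_rfl inf_le_right)
      (Measure.restrict_mono le_rfl inf_le_left)
  · refine le_inf ?_ ?_
    · conv_rhs => rw [← Measure.restrict_add_restrict_compl (μ := μ₁) hA]
      exact add_le_add hc.le_on le_rfl
    · conv_rhs => rw [← Measure.restrict_add_restrict_compl (μ := μ₂) hA]
      exact add_le_add le_rfl hc.le_off

lemma measureReal_inf (hc : SingleCrossing μ₁ μ₂ A) {B : Set ℝ} (hB : MeasurableSet B) :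
    (μ₁ ⊓ μ₂).real B = μ₂.real (B ∩ A) + μ₁.real (B \ A) := by
  rw [hc.inf_eq, measureReal_add_apply, measureReal_restrict_apply hB,
    measureReal_restrict_apply hB, Set.sdiff_eq]

/-- The mass of the excess of `μ₂` on a half-line inside the crossing set. -/
lemma excess_right_of_mem (hc : SingleCrossing μ₁ μ₂ A) {t : ℝ} (ht : t ∈ A) :
    (μ₂ - μ₂ ⊓ μ₁).real (Set.Iic t) = 0 := by
  have hsub : Set.Iic t ⊆ A := fun x hx => hc.isLowerSet hx ht
  rw [measureReal_excess, inf_comm, hc.measureReal_inf measurableSet_Iic,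
    Set.inter_eq_left.2 hsub, Set.sdiff_eq_empty.2 hsub]
  simp

lemma excess_left_of_notMem (hc : SingleCrossing μ₁ μ₂ A) {t : ℝ} (ht : t ∉ A) :
    (μ₁ - μ₁ ⊓ μ₂).real (Set.Iic t) = amrMass μ₁ μ₂ := by
  have hA := hc.measurableSet
  have hsub : A ⊆ Set.Iic t := fun x hx => by
    by_contra hlt
    exact ht (hc.isLowerSet (not_le.1 hlt).le hx)
  have h1 := hc.measureReal_inf MeasurableSet.univ
  rw [Set.univ_inter, ← Set.compl_eq_univ_sdiff] at h1
  have h2 := measureReal_inter_add_sdiff (μ := μ₁) (s := Set.Iic t) hA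
  have h3 := probReal_compl_eq_one_sub (μ := μ₁) hA
  rw [measureReal_excess, hc.measureReal_inf measurableSet_Iic, amrMass, h1]
  rw [Set.inter_eq_right.2 hsub] at h2 ⊢
  linarith

lemma excess_left_self (hc : SingleCrossing μ₁ μ₂ A) :
    (μ₁ - μ₁ ⊓ μ₂).real A = amrMass μ₁ μ₂ := by
  have hA := hc.measurableSet
  have h1 := hc.measureReal_inf MeasurableSet.univ
  rw [Set.univ_inter, ← Set.compl_eq_univ_sdiff] at h1
  have h3 := probReal_compl_eq_one_sub (μ := μ₁) hA
  rw [measureReal_excess, hc.measureReal_inf hA, amrMass, h1, Set.inter_self, Set.sdiff_self]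
  simp only [measureReal_empty]
  linarith

/-- The meet cancels, leaving the difference of the two excess distribution functions. Along `A`
only the excess of `μ₁` accumulates; beyond `A` it is exhausted and only that of `μ₂` is subtracted.
-/
lemma isBump (hc : SingleCrossing μ₁ μ₂ A) :
    IsBump (fun t => μ₁.real (Set.Iic t) - μ₂.real (Set.Iic t)) A := by
  have hdiff : ∀ t, μ₁.real (Set.Iic t) - μ₂.real (Set.Iic t) =
      (μ₁ - μ₁ ⊓ μ₂).real (Set.Iic t) - (μ₂ - μ₂ ⊓ μ₁).real (Set.Iic t) := fun t => by
    rw [measureReal_excess, measureReal_excess, inf_comm μ₂ μ₁]; ring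
  have hf1 : IsFiniteMeasure (μ₁ - μ₁ ⊓ μ₂) := isFiniteMeasure_of_le μ₁ Measure.sub_le
  have hf2 : IsFiniteMeasure (μ₂ - μ₂ ⊓ μ₁) := isFiniteMeasure_of_le μ₂ Measure.sub_le
  have hle : ∀ t, (μ₂ - μ₂ ⊓ μ₁).real (Set.Iic t) ≤ amrMass μ₁ μ₂ := fun t => by
    rw [amrMass_comm, ← measureReal_excess_univ]; exact measureReal_mono (Set.subset_univ _)
  refine ⟨hc.isLowerSet, ?_, ?_, ?_, ?_, ?_, ?_⟩
  · intro t ht t' ht' htt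
    simp only [hdiff, hc.excess_right_of_mem ht, hc.excess_right_of_mem ht', sub_zero]
    exact measureReal_mono (Set.Iic_subset_Iic.2 htt)
  · intro t ht t' ht' htt
    simp only [hdiff, hc.excess_left_of_notMem ht, hc.excess_left_of_notMem ht']
    exact sub_le_sub_left (measureReal_mono (Set.Iic_subset_Iic.2 htt)) _
  · intro t
    simp only [hdiff]
    by_cases ht : t ∈ A
    · rw [hc.excess_right_of_mem ht, sub_zero]; exact measureReal_nonneg
    · rw [hc.excess_left_of_notMem ht]; linarith [hle t]
  · intro t
    have h1 : μ₁.real (Set.Iic t) ≤ 1 := measureReal_le_one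
    have h2 : 0 ≤ μ₂.real (Set.Iic t) := measureReal_nonneg
    linarith
  · have := (tendsto_cdf_atTop μ₁).sub (tendsto_cdf_atTop μ₂)
    simpa only [cdf_eq_real, sub_self] using this
  · have := (tendsto_cdf_atBot μ₁).sub (tendsto_cdf_atBot μ₂)
    simpa only [cdf_eq_real, sub_self] using this

end SingleCrossing

/-! ### The dual functions -/

/-- Truncation to the interval `[s, s + K]`. -/
noncomputable def clamp (s K z : ℝ) : ℝ := min (max z s) (s + K)

@[fun_prop]
lemma measurable_clamp (s K : ℝ) : Measurable (clamp s K) := by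
  unfold clamp; fun_prop

/-- A truncation is 1-Lipschitz with range of length `K`. This is dual feasibility for the cost `min
K |w - v|`. -/
lemma clamp_sub_le {s K : ℝ} (hK : 0 ≤ K) (v w : ℝ) :
    clamp s K w - clamp s K v ≤ min K |w - v| := by
  unfold clamp
  have h1 := neg_abs_le (w - v)
  have h2 := le_abs_self (w - v)
  rcases le_total w s with h | h <;> rcases le_total v s with h' | h' <;>
  rcases le_total w (s + K) with h3 | h3 <;> rcases le_total v (s + K) with h4 | h4 <;>
  simp only [max_eq_left, max_eq_right, min_eq_left, min_eq_right, h, h', h3, h4,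
    le_add_iff_nonneg_right, hK, le_min_iff] <;> constructor <;> linarith

lemma abs_clamp_le (s : ℝ) {K : ℝ} (hK : 0 ≤ K) (z : ℝ) : |clamp s K z| ≤ |s| + K := by
  have h1 : s ≤ clamp s K z := le_min (le_max_right _ _) (by linarith)
  have h2 : clamp s K z ≤ s + K := min_le_right _ _
  rw [abs_le]
  constructor <;> linarith [neg_abs_le s, le_abs_self s]

lemma integrable_clamp (s : ℝ) {K : ℝ} (hK : 0 ≤ K) {Ω : Type*} [MeasurableSpace Ω]
    (P : Measure Ω) [IsFiniteMeasure P] {f : Ω → ℝ} (hf : Measurable f) :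
    Integrable (fun ω => clamp s K (f ω)) P :=
  Integrable.of_bound ((measurable_clamp s K).comp hf).aestronglyMeasurable (|s| + K)
    (Filter.Eventually.of_forall fun _ => abs_clamp_le s hK _)

/-- In the AMR coupling of two laws with a single crossing, some truncation separates the two
coordinates as well as possible. -/
lemma SingleCrossing.exists_clamp_eq {μ₁ μ₂ : Measure ℝ} [IsProbabilityMeasure μ₁]
    [IsProbabilityMeasure μ₂] {A : Set ℝ} (hc : SingleCrossing μ₁ μ₂ A) {K : ℝ} (hK : 0 < K) :
    ∃ s, ∀ᵐ r ∂amrLaw μ₁ μ₂, clamp s K r.2 - clamp s K r.1 = min K |r.2 - r.1| := by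
  have hb := hc.isBump
  obtain ⟨s, u₀, hu₀, hin, hout⟩ := hb.exists_level K
  have hdiff : ∀ t, μ₁.real (Set.Iic t) - μ₂.real (Set.Iic t) =
      (μ₁ - μ₁ ⊓ μ₂).real (Set.Iic t) - (μ₂ - μ₂ ⊓ μ₁).real (Set.Iic t) := fun t => by
    rw [measureReal_excess, measureReal_excess, inf_comm μ₂ μ₁]; ring
  set h : ℝ → ℝ := fun t => μ₁.real (Set.Iic t) - μ₂.real (Set.Iic t) with hh
  refine ⟨s, ?_⟩
  rw [amrLaw, ae_map_iff (aemeasurable_amrMap μ₁ μ₂)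
    (measurableSet_eq_fun (by fun_prop) (by fun_prop))]
  -- At the level itself neither of the two cases below applies; this single value of the uniform
  -- variable is null.
  have hne : ∀ᵐ v : ℝ ∂volume.restrict (Set.Ioo 0 1), v ≠ u₀ :=
    ae_restrict_of_ae (by simp [ae_iff, measure_singleton])
  filter_upwards [hne, ae_restrict_mem measurableSet_Ioo] with u hu hu01
  rcases le_or_gt (amrMass μ₁ μ₂) u with hq | hq
  · simp [amrMap_of_le _ _ hq, hK.le]
  have hq0 : 0 < amrMass μ₁ μ₂ := hu01.1.trans hq
  have hq0' : 0 < amrMass μ₂ μ₁ := amrMass_comm μ₁ μ₂ ▸ hq0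
  have := isProbabilityMeasure_amrExcess μ₁ μ₂ hq0.ne'
  have := isProbabilityMeasure_amrExcess μ₂ μ₁ hq0'.ne'
  rw [amrMap_of_lt _ _ hq]
  have hm1 : ∀ t, u / amrMass μ₁ μ₂ < (amrExcess μ₁ μ₂).real (Set.Iic t) ↔
      u < (μ₁ - μ₁ ⊓ μ₂).real (Set.Iic t) := fun t => by
    rw [measureReal_amrExcess, inv_mul_eq_div, div_lt_div_iff_of_pos_right hq0]
  have hm2 : ∀ t, (amrMass μ₁ μ₂ - u) / amrMass μ₁ μ₂ < (amrExcess μ₂ μ₁).real (Set.Iic t) ↔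
      amrMass μ₁ μ₂ - u < (μ₂ - μ₂ ⊓ μ₁).real (Set.Iic t) := fun t => by
    rw [measureReal_amrExcess, amrMass_comm μ₂ μ₁, inv_mul_eq_div, div_lt_div_iff_of_pos_right hq0]
  have hz1 : 0 < u / amrMass μ₁ μ₂ := div_pos hu01.1 hq0
  have hz1' : u / amrMass μ₁ μ₂ < 1 := (div_lt_one hq0).2 hq
  have hz2 : 0 < (amrMass μ₁ μ₂ - u) / amrMass μ₁ μ₂ := div_pos (sub_pos.2 hq) hq0
  have hz2' : (amrMass μ₁ μ₂ - u) / amrMass μ₁ μ₂ < 1 :=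
    (div_lt_one hq0).2 (by linarith [hu01.1])
  -- On `A`, `h` is the excess distribution function of `μ₁`; off `A`, it is the mass `q` minus that
  -- of `μ₂`. Hence both quantiles are crossings of the same level `u` by `h`: `V` on the way up,
  -- `W` on the way down. The next four facts encode this.
  have hV_le : ∀ t, (t ∈ A → u < h t) → quantile (amrExcess μ₁ μ₂) (u / amrMass μ₁ μ₂) ≤ t := by
    intro t ht
    refine quantile_le _ hz1 ((hm1 t).2 ?_)
    by_cases hA : t ∈ A
    · have := ht hA
      rw [hh] at this
      simp only [hdiff, hc.excess_right_of_mem hA, sub_zero] at this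
      exact this
    · rwa [hc.excess_left_of_notMem hA]
  have hle_V : ∀ b, (∀ t, (t ∈ A → u < h t) → b ≤ t) →
      b ≤ quantile (amrExcess μ₁ μ₂) (u / amrMass μ₁ μ₂) := by
    intro b hb'
    refine le_quantile _ hz1' fun t ht => hb' t fun hA => ?_
    rw [hh]
    simp only [hdiff, hc.excess_right_of_mem hA, sub_zero]
    exact (hm1 t).1 ht
  have hW_le : ∀ t, t ∉ A → h t < u →
      quantile (amrExcess μ₂ μ₁) ((amrMass μ₁ μ₂ - u) / amrMass μ₁ μ₂) ≤ t := by
    intro t hA ht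
    refine quantile_le _ hz2 ((hm2 t).2 ?_)
    rw [hh] at ht
    simp only [hdiff, hc.excess_left_of_notMem hA] at ht
    linarith
  have hle_W : ∀ b, (∀ t, t ∉ A → h t < u → b ≤ t) →
      b ≤ quantile (amrExcess μ₂ μ₁) ((amrMass μ₁ μ₂ - u) / amrMass μ₁ μ₂) := by
    intro b hb'
    refine le_quantile _ hz2' fun t ht => ?_
    have ht' := (hm2 t).1 ht
    by_cases hA : t ∈ A
    · rw [hc.excess_right_of_mem hA] at ht'; linarith
    · refine hb' t hA ?_
      rw [hh]
      simp only [hdiff, hc.excess_left_of_notMem hA]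
      linarith
  generalize quantile (amrExcess μ₁ μ₂) (u / amrMass μ₁ μ₂) = V at *
  generalize quantile (amrExcess μ₂ μ₁) ((amrMass μ₁ μ₂ - u) / amrMass μ₁ μ₂) = W at *
  have hlow : ∀ t t', t ∈ A → t' ∉ A → t ≤ t' := fun t t' ht ht' => by
    by_contra! hlt
    exact ht' (hc.isLowerSet hlt.le ht)
  have hVW : V ≤ W := hle_W V fun t hA _ => hV_le t fun h' => absurd h' hA
  rcases lt_or_gt_of_ne hu with hlt | hgt
  · -- below the level, the two coordinates lie on both sides of the interval
    have h1 : V ≤ s := by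
      refine le_of_forall_gt_imp_ge_of_dense fun t ht => ?_
      by_cases ht2 : t < s + K
      · exact hV_le t fun _ => hlt.trans_le (hout t ⟨ht, ht2⟩)
      · have hmid : s + K / 2 ∈ Set.Ioo s (s + K) := by constructor <;> linarith
        exact (hV_le _ fun _ => hlt.trans_le (hout _ hmid)).trans (by linarith)
    have h2 : s + K ≤ W := by
      refine hle_W _ fun t hA ht => ?_
      by_contra! htK
      have hts : t ≤ s := by
        by_contra! hts
        linarith [hout t ⟨hts, htK⟩]
      -- The midpoint lies to the right of `t`, hence off `A`, so `h` there is at most `h t < u₀`;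
      -- but `h` is at least `u₀` inside the interval.
      have hmid : s + K / 2 ∈ Set.Ioo s (s + K) := by constructor <;> linarith
      have hmA : s + K / 2 ∉ A := fun h' => hA (hc.isLowerSet (by linarith) h')
      have := hb.antitoneOn hA hmA (by linarith)
      have := hout _ hmid
      linarith
    have e1 : clamp s K V = s := by
      rw [clamp, max_eq_right h1, min_eq_left (by linarith)]
    have e2 : clamp s K W = s + K := by
      rw [clamp, max_eq_left (by linarith), min_eq_right h2]
    rw [e1, e2, abs_of_nonneg (by linarith), min_eq_left (by linarith)]
    ring
  · -- above the level, both coordinates lie in the interval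
    obtain ⟨a, haA, ha⟩ : ∃ a ∈ A, u < h a := by
      have hfin : IsFiniteMeasure (μ₁ - μ₁ ⊓ μ₂) := isFiniteMeasure_of_le μ₁ Measure.sub_le
      have hEA : ENNReal.ofReal u < (μ₁ - μ₁ ⊓ μ₂) A := by
        rw [← ofReal_measureReal, hc.excess_left_self]
        exact (ENNReal.ofReal_lt_ofReal_iff hq0).2 hq
      -- `A` need not have a greatest element. Inner regularity gives a compact part of `A` that
      -- still has excess mass above `u`, and its maximum is the required point.
      obtain ⟨C, hCA, hC, hCu⟩ := hc.measurableSet.exists_lt_isCompact_of_ne_top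
        (measure_ne_top _ _) hEA
      have hCne : C.Nonempty := by
        rw [Set.nonempty_iff_ne_empty]
        rintro rfl
        simp at hCu
      obtain ⟨a, haC, ha⟩ := hC.exists_isGreatest hCne
      refine ⟨a, hCA haC, ?_⟩
      rw [hh]
      simp only [hdiff, hc.excess_right_of_mem (hCA haC), sub_zero]
      exact (ENNReal.ofReal_lt_iff_lt_toReal hu01.1.le (measure_ne_top _ _)).1
        (hCu.trans_le (measure_mono fun x hx => ha hx))
    have hau := hin a (hgt.trans ha)
    have h1 : s ≤ V := hle_V _ fun t ht => by
      by_cases hA : t ∈ A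
      · exact (hin t (hgt.trans (ht hA))).1
      · exact hau.1.trans (hlow a t haA hA)
    have h2 : W ≤ s + K := by
      refine le_of_forall_gt_imp_ge_of_dense fun t ht => ?_
      have hout' : ∀ x, s + K < x → h x ≤ u₀ := fun x hx => by
        by_contra! hlt
        linarith [(hin x hlt).2]
      refine hW_le t (fun hA => ?_) ((hout' t ht).trans_lt hgt)
      have := hb.monotoneOn haA hA (hau.2.trans ht.le)
      linarith [hout' t ht]
    have e1 : clamp s K V = V := by
      rw [clamp, max_eq_left h1, min_eq_left (by linarith)]
    have e2 : clamp s K W = W := by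
      rw [clamp, max_eq_left (by linarith), min_eq_left h2]
    rw [e1, e2, abs_of_nonneg (by linarith), min_eq_right (by linarith)]

/-! ### Convex bounded nonincreasing payoffs -/

/-- Convex, nonincreasing and bounded on `[0, ∞)`. A jump at `0` is allowed: this class, unlike the
one with continuity at `0`, is stable under bounded pointwise limits. -/
structure IsPayoff (φ : ℝ → ℝ) : Prop where
  convexOn : ConvexOn ℝ (Set.Ici 0) φ
  antitoneOn : AntitoneOn φ (Set.Ici 0)
  bounded : ∃ C, ∀ x, 0 ≤ x → |φ x| ≤ C

/-- The payoff `d ↦ (K - d)⁺`. -/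
noncomputable def hinge (K d : ℝ) : ℝ := max (K - d) 0

@[fun_prop]
lemma measurable_hinge (K : ℝ) : Measurable (hinge K) := by
  unfold hinge; fun_prop

lemma hinge_eq_sub_min (K d : ℝ) : hinge K d = K - min K d := by
  unfold hinge
  rcases le_total K d with h | h
  · rw [max_eq_right (by linarith), min_eq_left h, sub_self]
  · rw [max_eq_left (by linarith), min_eq_right h]

lemma hinge_nonneg (K d : ℝ) : 0 ≤ hinge K d := le_max_right _ _

lemma abs_hinge_le {K d : ℝ} (hK : 0 ≤ K) (hd : 0 ≤ d) : |hinge K d| ≤ K := by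
  rw [abs_of_nonneg (hinge_nonneg K d)]
  exact max_le (by linarith) hK

lemma isPayoff_hinge {K : ℝ} (hK : 0 ≤ K) : IsPayoff (hinge K) := by
  refine ⟨⟨convex_Ici 0, ?_⟩, ?_, K, fun x hx => abs_hinge_le hK hx⟩
  · intro x _ y _ a b ha hb hab
    simp only [hinge, smul_eq_mul]
    refine max_le ?_ (by positivity)
    have h1 := mul_le_mul_of_nonneg_left (le_max_left (K - x) 0) ha
    have h2 := mul_le_mul_of_nonneg_left (le_max_left (K - y) 0) hb
    have h3 : K = a * K + b * K := by rw [← add_mul, hab, one_mul]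
    linarith
  · intro x _ y _ hxy
    exact max_le_max (by linarith) le_rfl

namespace IsPayoff

variable {φ : ℝ → ℝ}

lemma measurable_abs (hφ : IsPayoff φ) : Measurable fun x => φ |x| := by
  -- Nothing is known of `φ` on negative numbers, so it is replaced by a function that is monotone
  -- on the whole line and agrees with it on `[0, ∞)`.
  have h : Antitone fun x => φ (max x 0) := fun x y hxy =>
    hφ.antitoneOn (le_max_right x 0) (le_max_right y 0) (max_le_max hxy le_rfl)
  have : (fun x => φ |x|) = (fun x => φ (max x 0)) ∘ fun x => |x| := by
    ext x; simp
  rw [this]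
  exact h.measurable.comp (by fun_prop)

lemma integrable_comp (hφ : IsPayoff φ) {Ω : Type*} [MeasurableSpace Ω] {P : Measure Ω}
    [IsFiniteMeasure P] {f : Ω → ℝ} (hf : AEMeasurable f P) :
    Integrable (fun ω => φ |f ω|) P := by
  obtain ⟨C, hC⟩ := hφ.bounded
  exact Integrable.of_bound (hφ.measurable_abs.comp_aemeasurable hf).aestronglyMeasurable C
    (Filter.Eventually.of_forall fun ω => hC _ (abs_nonneg _))

lemma continuousAt (hφ : IsPayoff φ) {d : ℝ} (hd : 0 < d) : ContinuousAt φ d := by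
  have h := hφ.convexOn.continuousOn_interior
  rw [interior_Ici] at h
  exact h.continuousAt (Ioi_mem_nhds hd)

end IsPayoff

/-- The decrement of `φ` over the `j`-th cell of the grid of mesh `δ`. -/
noncomputable def gridDrop (φ : ℝ → ℝ) (δ : ℝ) (j : ℕ) : ℝ := φ (j * δ) - φ ((j + 1 : ℕ) * δ)

/-- The piecewise linear function with corners on the grid of mesh `δ` that interpolates `φ` on
`[0, N δ]` and is constant afterwards. -/
noncomputable def interpolant (φ : ℝ → ℝ) (δ : ℝ) (N : ℕ) (d : ℝ) : ℝ :=
  φ (N * δ) + ∑ j ∈ Finset.range N,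
    gridDrop φ δ j * ((hinge ((j + 1 : ℕ) * δ) d - hinge (j * δ) d) / δ)

/-- The form suited to induction: the bracket vanishes for `d ≤ N δ` and equals `-1` beyond the new
cell, so a further cell never alters the earlier ones. -/
lemma interpolant_succ (φ : ℝ → ℝ) (δ : ℝ) (N : ℕ) (d : ℝ) :
    interpolant φ δ (N + 1) d = interpolant φ δ N d +
      gridDrop φ δ N * ((hinge ((N + 1 : ℕ) * δ) d - hinge (N * δ) d) / δ - 1) := by
  rw [interpolant, interpolant, Finset.sum_range_succ, gridDrop]
  ring

lemma interpolant_zero_arg (φ : ℝ → ℝ) {δ : ℝ} (hδ : 0 < δ) (N : ℕ) :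
    interpolant φ δ N 0 = φ 0 := by
  induction N with
  | zero => simp [interpolant]
  | succ N ih =>
    have h1 : hinge ((N + 1 : ℕ) * δ) 0 = (N + 1 : ℕ) * δ := by
      rw [hinge, sub_zero, max_eq_left (by positivity)]
    have h2 : hinge (N * δ) 0 = N * δ := by
      rw [hinge, sub_zero, max_eq_left (by positivity)]
    rw [interpolant_succ, ih, h1, h2]
    push_cast
    field_simp
    ring

lemma interpolant_of_le (φ : ℝ → ℝ) {δ : ℝ} (hδ : 0 < δ) (N : ℕ) {d : ℝ} (hd : N * δ ≤ d) :
    interpolant φ δ N d = φ (N * δ) := by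
  rw [interpolant, Finset.sum_eq_zero, add_zero]
  intro j hj
  have hj' : ((j + 1 : ℕ) : ℝ) ≤ N := by exact_mod_cast Finset.mem_range.1 hj
  have hj2 : ((j : ℕ) : ℝ) ≤ N := by push_cast at hj'; linarith
  have h1 : hinge ((j + 1 : ℕ) * δ) d = 0 := max_eq_right (by nlinarith)
  have h2 : hinge (j * δ) d = 0 := max_eq_right (by nlinarith)
  rw [h1, h2]; simp

lemma interpolant_mem_Icc {φ : ℝ → ℝ} (hφ : IsPayoff φ) {δ : ℝ} (hδ : 0 < δ) {N i : ℕ}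
    (hi : i < N) {d : ℝ} (h1 : i * δ ≤ d) (h2 : d ≤ (i + 1 : ℕ) * δ) :
    interpolant φ δ N d ∈ Set.Icc (φ ((i + 1 : ℕ) * δ)) (φ (i * δ)) := by
  have hdrop : 0 ≤ gridDrop φ δ i := sub_nonneg.2 (hφ.antitoneOn
    (Set.mem_Ici.2 (by positivity)) (Set.mem_Ici.2 (by positivity)) (h1.trans h2))
  induction N, hi using Nat.le_induction with
  | base =>
    rw [interpolant_succ, interpolant_of_le φ hδ i h1]
    have e1 : hinge ((i + 1 : ℕ) * δ) d = (i + 1 : ℕ) * δ - d := max_eq_left (by linarith)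
    have e2 : hinge (i * δ) d = 0 := max_eq_right (by linarith)
    have e3 : (0 : ℝ) ≤ ((i + 1 : ℕ) * δ - d - 0) / δ := div_nonneg (by linarith) hδ.le
    have e4 : ((i + 1 : ℕ) * δ - d - 0) / δ ≤ 1 := by
      rw [div_le_one hδ]; push_cast at *; linarith
    rw [e1, e2]
    generalize ((i + 1 : ℕ) * δ - d - 0) / δ = r at *
    have hg : φ ((i + 1 : ℕ) * δ) = φ (i * δ) - gridDrop φ δ i := by rw [gridDrop]; ring
    rw [hg]
    constructor <;> nlinarith
  | succ N hN ih =>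
    have hN' : ((i + 1 : ℕ) : ℝ) ≤ N := by exact_mod_cast hN
    have hd : d ≤ N * δ := h2.trans (mul_le_mul_of_nonneg_right hN' hδ.le)
    have e1 : hinge ((N + 1 : ℕ) * δ) d = (N + 1 : ℕ) * δ - d :=
      max_eq_left (by push_cast; nlinarith)
    have e2 : hinge (N * δ) d = N * δ - d := max_eq_left (by linarith)
    have e3 : ((N + 1 : ℕ) * δ - d - (N * δ - d)) / δ - 1 = 0 := by
      push_cast; field_simp; ring
    rw [interpolant_succ, e1, e2, e3, mul_zero, add_zero]
    exact ih

lemma exists_grid_cell {δ : ℝ} (hδ : 0 < δ) {d : ℝ} (hd : 0 ≤ d) :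
    (⌊d / δ⌋₊ : ℝ) * δ ≤ d ∧ d ≤ (⌊d / δ⌋₊ + 1 : ℕ) * δ := by
  constructor
  · exact (le_div_iff₀ hδ).1 (Nat.floor_le (by positivity))
  · have := (Nat.lt_floor_add_one (d / δ)).le
    push_cast
    exact (div_le_iff₀ hδ).1 this

lemma abs_interpolant_le {φ : ℝ → ℝ} (hφ : IsPayoff φ) {C : ℝ} (hC : ∀ x, 0 ≤ x → |φ x| ≤ C)
    {δ : ℝ} (hδ : 0 < δ) (N : ℕ) {d : ℝ} (hd : 0 ≤ d) : |interpolant φ δ N d| ≤ C := by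
  obtain ⟨h1, h2⟩ := exists_grid_cell hδ hd
  rcases lt_or_ge ⌊d / δ⌋₊ N with hN | hN
  · have h := interpolant_mem_Icc hφ hδ hN h1 h2
    have h3 := abs_le.1 (hC _ (by positivity : (0 : ℝ) ≤ (⌊d / δ⌋₊ + 1 : ℕ) * δ))
    have h4 := abs_le.1 (hC _ (by positivity : (0 : ℝ) ≤ ⌊d / δ⌋₊ * δ))
    exact abs_le.2 ⟨h3.1.trans h.1, h.2.trans h4.2⟩
  · rw [interpolant_of_le φ hδ N]
    · exact hC _ (by positivity)
    · exact le_trans (mul_le_mul_of_nonneg_right (by exact_mod_cast hN) hδ.le) h1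

/-- With mesh `1 / (m + 1)` and `(m + 1) ^ 2` cells the grid reaches `m + 1`, so it becomes fine and
long together. At `0` the interpolant is exact, so a jump there is harmless; elsewhere convexity
gives continuity. -/
lemma tendsto_interpolant {φ : ℝ → ℝ} (hφ : IsPayoff φ) {d : ℝ} (hd : 0 ≤ d) :
    Filter.Tendsto (fun m : ℕ => interpolant φ (1 / ((m : ℝ) + 1)) ((m + 1) ^ 2) d) Filter.atTop
      (nhds (φ d)) := by
  have hpos : ∀ m : ℕ, (0 : ℝ) < 1 / ((m : ℝ) + 1) := fun m => by positivity
  rcases hd.eq_or_lt with rfl | hd0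
  · simp only [interpolant_zero_arg φ (hpos _)]
    exact tendsto_const_nhds
  have hδ : Filter.Tendsto (fun m : ℕ => 1 / ((m : ℝ) + 1)) Filter.atTop (nhds 0) :=
    tendsto_one_div_add_atTop_nhds_zero_nat
  have hcont := hφ.continuousAt hd0
  have hl : Filter.Tendsto (fun m : ℕ => (⌊d / (1 / ((m : ℝ) + 1))⌋₊ : ℝ) * (1 / ((m : ℝ) + 1)))
      Filter.atTop (nhds d) := by
    have h1 : Filter.Tendsto (fun m : ℕ => d - 1 / ((m : ℝ) + 1)) Filter.atTop (nhds d) := by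
      simpa using tendsto_const_nhds.sub hδ
    refine tendsto_of_tendsto_of_tendsto_of_le_of_le h1 tendsto_const_nhds (fun m => ?_)
      (fun m => (exists_grid_cell (hpos m) hd).1)
    have := (exists_grid_cell (hpos m) hd).2
    push_cast at this
    simp only
    linarith
  have hr : Filter.Tendsto
      (fun m : ℕ => ((⌊d / (1 / ((m : ℝ) + 1))⌋₊ + 1 : ℕ) : ℝ) * (1 / ((m : ℝ) + 1)))
      Filter.atTop (nhds d) := by
    have := hl.add hδ
    rw [add_zero] at this
    refine this.congr fun m => ?_
    push_cast; ring
  have hN : ∀ᶠ m : ℕ in Filter.atTop, ⌊d / (1 / ((m : ℝ) + 1))⌋₊ < (m + 1) ^ 2 := by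
    filter_upwards [Filter.eventually_ge_atTop ⌈d⌉₊] with m hm
    rw [Nat.floor_lt (by positivity)]
    have h1 : d ≤ m := Nat.ceil_le.1 hm
    push_cast
    rw [div_div_eq_mul_div, div_one]
    nlinarith
  refine tendsto_of_tendsto_of_tendsto_of_le_of_le' (hcont.tendsto.comp hr)
    (hcont.tendsto.comp hl) ?_ ?_
  · filter_upwards [hN] with m hm
    exact (interpolant_mem_Icc hφ (hpos m) hm (exists_grid_cell (hpos m) hd).1
      (exists_grid_cell (hpos m) hd).2).1
  · filter_upwards [hN] with m hm
    exact (interpolant_mem_Icc hφ (hpos m) hm (exists_grid_cell (hpos m) hd).1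
      (exists_grid_cell (hpos m) hd).2).2

lemma gridDrop_antitone {φ : ℝ → ℝ} (hφ : IsPayoff φ) {δ : ℝ} (hδ : 0 < δ) (j : ℕ) :
    gridDrop φ δ (j + 1) ≤ gridDrop φ δ j := by
  have h := hφ.convexOn.2 (Set.mem_Ici.2 (by positivity : (0 : ℝ) ≤ j * δ))
    (Set.mem_Ici.2 (by positivity : (0 : ℝ) ≤ (j + 1 + 1 : ℕ) * δ))
    (by norm_num : (0 : ℝ) ≤ 1 / 2) (by norm_num : (0 : ℝ) ≤ 1 / 2) (by norm_num)
  have e : (1 / 2 : ℝ) • (j * δ) + (1 / 2 : ℝ) • ((j + 1 + 1 : ℕ) * δ) = (j + 1 : ℕ) * δ := by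
    push_cast; simp only [smul_eq_mul]; ring
  rw [e] at h
  simp only [smul_eq_mul] at h
  unfold gridDrop
  linarith

lemma integrable_hinge {K : ℝ} (hK : 0 ≤ K) {ρ : Measure ℝ} [IsFiniteMeasure ρ]
    (hρ : ∀ᵐ d ∂ρ, 0 ≤ d) : Integrable (hinge K) ρ :=
  Integrable.of_bound (measurable_hinge K).aestronglyMeasurable K
    (hρ.mono fun _ hd => abs_hinge_le hK hd)

lemma integral_interpolant (φ : ℝ → ℝ) {δ : ℝ} (hδ : 0 < δ) (N : ℕ) {ρ : Measure ℝ}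
    [IsProbabilityMeasure ρ] (hρ : ∀ᵐ d ∂ρ, 0 ≤ d) :
    ∫ d, interpolant φ δ N d ∂ρ = φ (N * δ) + ∑ j ∈ Finset.range N, gridDrop φ δ j *
      ((∫ d, hinge ((j + 1 : ℕ) * δ) d ∂ρ - ∫ d, hinge (j * δ) d ∂ρ) / δ) := by
  have hi : ∀ j : ℕ, Integrable (hinge (j * δ)) ρ := fun j => integrable_hinge (by positivity) hρ
  have hj : ∀ j ∈ Finset.range N, Integrable (fun d => gridDrop φ δ j *
      ((hinge ((j + 1 : ℕ) * δ) d - hinge (j * δ) d) / δ)) ρ := fun j _ =>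
    (((hi (j + 1)).sub (hi j)).div_const δ).const_mul _
  simp only [interpolant]
  rw [integral_add (integrable_const _) (integrable_finsetSum _ hj), integral_const,
    integral_finsetSum _ hj]
  simp only [probReal_univ, one_smul]
  congr 1
  refine Finset.sum_congr rfl fun j _ => ?_
  rw [integral_const_mul, integral_div, integral_sub (hi (j + 1)) (hi j)]

/-- Comparison of two laws on `[0, ∞)` against the payoffs `(K - d)⁺` implies comparison against
all convex bounded nonincreasing payoffs. -/
lemma integral_le_of_hinge {ρ₁ ρ₂ : Measure ℝ} [IsProbabilityMeasure ρ₁] [IsProbabilityMeasure ρ₂]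
    (h₁ : ∀ᵐ d ∂ρ₁, 0 ≤ d) (h₂ : ∀ᵐ d ∂ρ₂, 0 ≤ d)
    (h : ∀ K, 0 < K → ∫ d, hinge K d ∂ρ₁ ≤ ∫ d, hinge K d ∂ρ₂) {φ : ℝ → ℝ} (hφ : IsPayoff φ) :
    ∫ d, φ d ∂ρ₁ ≤ ∫ d, φ d ∂ρ₂ := by
  obtain ⟨C, hC⟩ := hφ.bounded
  have hpos : ∀ m : ℕ, (0 : ℝ) < 1 / ((m : ℝ) + 1) := fun m => by positivity
  have hmeas : ∀ (δ : ℝ) (N : ℕ), Measurable (interpolant φ δ N) := fun δ N => by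
    unfold interpolant; fun_prop
  have hlim : ∀ (ρ : Measure ℝ) [IsProbabilityMeasure ρ], (∀ᵐ d ∂ρ, 0 ≤ d) →
      Filter.Tendsto (fun m : ℕ => ∫ d, interpolant φ (1 / ((m : ℝ) + 1)) ((m + 1) ^ 2) d ∂ρ)
        Filter.atTop (nhds (∫ d, φ d ∂ρ)) := fun ρ _ hρ =>
    tendsto_integral_of_dominated_convergence (fun _ => C)
      (fun m => (hmeas _ _).aestronglyMeasurable) (integrable_const C)
      (fun m => hρ.mono fun d hd => abs_interpolant_le hφ hC (hpos m) _ hd)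
      (hρ.mono fun d hd => tendsto_interpolant hφ hd)
  refine le_of_tendsto_of_tendsto' (hlim ρ₁ h₁) (hlim ρ₂ h₂) fun m => ?_
  generalize hδ' : 1 / ((m : ℝ) + 1) = δ
  have hδ : 0 < δ := hδ' ▸ hpos m
  rw [integral_interpolant φ hδ _ h₁, integral_interpolant φ hδ _ h₂]
  refine add_le_add_right ?_ _
  have hdrop : ∀ j, 0 ≤ gridDrop φ δ j := fun j => sub_nonneg.2 (hφ.antitoneOn
    (Set.mem_Ici.2 (by positivity)) (Set.mem_Ici.2 (by positivity))
    (mul_le_mul_of_nonneg_right (by push_cast; linarith) hδ.le))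
  set D : ℕ → ℝ := fun j => ∫ d, hinge (j * δ) d ∂ρ₂ - ∫ d, hinge (j * δ) d ∂ρ₁ with hD
  have hD0 : D 0 = 0 := by
    have hz : ∀ (ρ : Measure ℝ), (∀ᵐ d ∂ρ, 0 ≤ d) → ∫ d, hinge ((0 : ℕ) * δ) d ∂ρ = 0 :=
      fun ρ hρ => integral_eq_zero_of_ae (hρ.mono fun d hd => by
        simp [hinge, hd])
    simp only [hD, hz ρ₁ h₁, hz ρ₂ h₂, sub_zero]
  have hDnn : ∀ j, 0 ≤ D j := fun j => by
    rcases Nat.eq_zero_or_pos j with rfl | hj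
    · exact hD0.ge
    · exact sub_nonneg.2 (h _ (by positivity))
  -- Abel summation: `D` is nonnegative and starts at `0`, and by convexity the drops decrease.
  have hsum : ∀ N, gridDrop φ δ N * D N ≤
      ∑ j ∈ Finset.range N, gridDrop φ δ j * (D (j + 1) - D j) := by
    intro N
    induction N with
    | zero => simp [hD0]
    | succ N ih =>
      rw [Finset.sum_range_succ]
      have := mul_le_mul_of_nonneg_right (gridDrop_antitone hφ hδ N) (hDnn (N + 1))
      linarith
  have h0 := (mul_nonneg (hdrop _) (hDnn _)).trans (hsum ((m + 1) ^ 2))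
  rw [← sub_nonneg, ← Finset.sum_sub_distrib]
  have : ∀ j, gridDrop φ δ j *
      ((∫ d, hinge ((j + 1 : ℕ) * δ) d ∂ρ₂ - ∫ d, hinge (j * δ) d ∂ρ₂) / δ) - gridDrop φ δ j *
      ((∫ d, hinge ((j + 1 : ℕ) * δ) d ∂ρ₁ - ∫ d, hinge (j * δ) d ∂ρ₁) / δ) =
      (gridDrop φ δ j * (D (j + 1) - D j)) / δ := fun j => by
    simp only [hD]; ring
  simp only [this]
  rw [← Finset.sum_div]
  exact div_nonneg h0 hδ.le

/-! ### Optimality of the AMR coupling in one step -/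

/-- Expected payoff of the distance between the two coordinates of a law on the plane. -/
noncomputable def payoff (φ : ℝ → ℝ) (π : Measure (ℝ × ℝ)) : ℝ := ∫ r, φ |r.1 - r.2| ∂π

lemma payoff_le_of_hinge {π₁ π₂ : Measure (ℝ × ℝ)} [IsProbabilityMeasure π₁]
    [IsProbabilityMeasure π₂] (h : ∀ K, 0 < K → payoff (hinge K) π₁ ≤ payoff (hinge K) π₂)
    {φ : ℝ → ℝ} (hφ : IsPayoff φ) : payoff φ π₁ ≤ payoff φ π₂ := by
  have hm : Measurable fun r : ℝ × ℝ => |r.1 - r.2| := by fun_prop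
  have hmap : ∀ (π : Measure (ℝ × ℝ)) {ψ : ℝ → ℝ}, IsPayoff ψ →
      ∫ d, ψ d ∂(π.map fun r => |r.1 - r.2|) = payoff ψ π := by
    intro π ψ hψ
    have hnn : ∀ᵐ d ∂(π.map fun r : ℝ × ℝ => |r.1 - r.2|), 0 ≤ d :=
      (ae_map_iff hm.aemeasurable measurableSet_Ici).2 (Filter.Eventually.of_forall fun r =>
        abs_nonneg _)
    have : ∫ d, ψ d ∂(π.map fun r : ℝ × ℝ => |r.1 - r.2|) =
        ∫ d, ψ |d| ∂(π.map fun r : ℝ × ℝ => |r.1 - r.2|) :=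
      integral_congr_ae (hnn.mono fun d hd => by simp only [abs_of_nonneg hd])
    rw [this, integral_map hm.aemeasurable hψ.measurable_abs.aestronglyMeasurable, payoff]
    simp only [abs_abs]
  have hnn : ∀ (π : Measure (ℝ × ℝ)), ∀ᵐ d ∂(π.map fun r : ℝ × ℝ => |r.1 - r.2|), 0 ≤ d :=
    fun π => (ae_map_iff hm.aemeasurable measurableSet_Ici).2
      (Filter.Eventually.of_forall fun r => abs_nonneg _)
  have := Measure.isProbabilityMeasure_map (μ := π₁) hm.aemeasurable
  have := Measure.isProbabilityMeasure_map (μ := π₂) hm.aemeasurable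
  rw [← hmap π₁ hφ, ← hmap π₂ hφ]
  refine integral_le_of_hinge (hnn π₁) (hnn π₂) (fun K hK => ?_) hφ
  rw [hmap π₁ (isPayoff_hinge hK.le), hmap π₂ (isPayoff_hinge hK.le)]
  exact h K hK

/-- `π` has marginals `μ₁` and `μ₂`. -/
structure IsCoupling (π : Measure (ℝ × ℝ)) (μ₁ μ₂ : Measure ℝ) : Prop where
  map_fst : π.map Prod.fst = μ₁
  map_snd : π.map Prod.snd = μ₂

lemma isCoupling_amrLaw (μ₁ μ₂ : Measure ℝ) [IsProbabilityMeasure μ₁] [IsProbabilityMeasure μ₂] :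
    IsCoupling (amrLaw μ₁ μ₂) μ₁ μ₂ :=
  ⟨amrLaw_map_fst μ₁ μ₂, amrLaw_map_snd μ₁ μ₂⟩

lemma IsCoupling.integral_clamp_sub {π : Measure (ℝ × ℝ)} [IsProbabilityMeasure π]
    {μ₁ μ₂ : Measure ℝ} (hπ : IsCoupling π μ₁ μ₂) (s : ℝ) {K : ℝ} (hK : 0 ≤ K) :
    ∫ r, (K - (clamp s K r.2 - clamp s K r.1)) ∂π =
      K - (∫ y, clamp s K y ∂μ₂ - ∫ x, clamp s K x ∂μ₁) := by
  rw [← hπ.map_fst, ← hπ.map_snd,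
    integral_map measurable_fst.aemeasurable (measurable_clamp s K).aestronglyMeasurable,
    integral_map measurable_snd.aemeasurable (measurable_clamp s K).aestronglyMeasurable]
  have h1 := integrable_clamp s hK π (measurable_fst (α := ℝ) (β := ℝ))
  have h2 := integrable_clamp s hK π (measurable_snd (α := ℝ) (β := ℝ))
  have h3 : Integrable (fun r : ℝ × ℝ => clamp s K r.2 - clamp s K r.1) π := h2.sub h1
  rw [integral_sub (integrable_const K) h3, integral_sub h2 h1]
  simp

/-- Weak duality: the bound depends on the coupling only through its marginals. -/
lemma IsCoupling.payoff_hinge_le {π : Measure (ℝ × ℝ)} [IsProbabilityMeasure π]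
    {μ₁ μ₂ : Measure ℝ} (hπ : IsCoupling π μ₁ μ₂) (s : ℝ) {K : ℝ} (hK : 0 ≤ K) :
    payoff (hinge K) π ≤ K - (∫ y, clamp s K y ∂μ₂ - ∫ x, clamp s K x ∂μ₁) := by
  rw [← hπ.integral_clamp_sub s hK, payoff]
  have h1 := integrable_clamp s hK π (measurable_fst (α := ℝ) (β := ℝ))
  have h2 := integrable_clamp s hK π (measurable_snd (α := ℝ) (β := ℝ))
  refine integral_mono ((isPayoff_hinge hK).integrable_comp (by fun_prop))
    ((integrable_const K).sub (h2.sub h1)) fun r => ?_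
  simp only [hinge_eq_sub_min]
  rw [abs_sub_comm]
  exact sub_le_sub_left (clamp_sub_le hK _ _) K

/-- Absence of a duality gap: the truncation from `SingleCrossing.exists_clamp_eq` is tight almost
surely. -/
lemma SingleCrossing.exists_payoff_hinge_eq {μ₁ μ₂ : Measure ℝ} [IsProbabilityMeasure μ₁]
    [IsProbabilityMeasure μ₂] {A : Set ℝ} (hc : SingleCrossing μ₁ μ₂ A) {K : ℝ} (hK : 0 < K) :
    ∃ s, payoff (hinge K) (amrLaw μ₁ μ₂) =
      K - (∫ y, clamp s K y ∂μ₂ - ∫ x, clamp s K x ∂μ₁) := by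
  obtain ⟨s, hs⟩ := hc.exists_clamp_eq hK
  refine ⟨s, ?_⟩
  rw [← (isCoupling_amrLaw μ₁ μ₂).integral_clamp_sub s hK.le, payoff]
  refine integral_congr_ae (hs.mono fun r hr => ?_)
  simp only [hinge_eq_sub_min]
  rw [hr, abs_sub_comm]

/-- The AMR coupling of two laws with a single crossing maximises all convex bounded nonincreasing
payoffs of the distance. -/
theorem SingleCrossing.payoff_le {μ₁ μ₂ : Measure ℝ} [IsProbabilityMeasure μ₁]
    [IsProbabilityMeasure μ₂] {A : Set ℝ} (hc : SingleCrossing μ₁ μ₂ A) {π : Measure (ℝ × ℝ)}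
    [IsProbabilityMeasure π] (hπ : IsCoupling π μ₁ μ₂) {φ : ℝ → ℝ} (hφ : IsPayoff φ) :
    payoff φ π ≤ payoff φ (amrLaw μ₁ μ₂) := by
  refine payoff_le_of_hinge (fun K hK => ?_) hφ
  obtain ⟨s, hs⟩ := hc.exists_payoff_hinge_eq hK
  rw [hs]
  exact hπ.payoff_hinge_le s hK.le

/-! ### Translates of the jump law -/

/-- The law of `x + ξ` where `ξ` has law `μ`. -/
noncomputable def shift (μ : Measure ℝ) (x : ℝ) : Measure ℝ := μ.map (fun y => x + y)

instance (μ : Measure ℝ) [IsProbabilityMeasure μ] (x : ℝ) : IsProbabilityMeasure (shift μ x) :=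
  Measure.isProbabilityMeasure_map (by fun_prop)

lemma shift_map_add (μ : Measure ℝ) (x z : ℝ) :
    (shift μ x).map (fun y => z + y) = shift μ (z + x) := by
  rw [shift, shift, Measure.map_map (by fun_prop) (by fun_prop)]
  congr 1
  ext y
  simp [add_assoc]

lemma measureReal_shift_Iic (μ : Measure ℝ) (x t : ℝ) :
    (shift μ x).real (Set.Iic t) = μ.real (Set.Iic (t - x)) := by
  rw [shift, map_measureReal_apply (by fun_prop) measurableSet_Iic]
  congr 1
  ext y
  simp only [Set.mem_preimage, Set.mem_Iic]
  constructor <;> intro h <;> linarith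

lemma shift_add (μ ν : Measure ℝ) (x : ℝ) : shift (μ + ν) x = shift μ x + shift ν x :=
  Measure.map_add _ _ (by fun_prop)

lemma shift_smul (c : ℝ≥0∞) (μ : Measure ℝ) (x : ℝ) : shift (c • μ) x = c • shift μ x :=
  Measure.map_smul _ _ _

lemma shift_dirac (x y : ℝ) : shift (Measure.dirac y) x = Measure.dirac (x + y) :=
  Measure.map_dirac' (by fun_prop) _

lemma shift_withDensity (g : ℝ → ℝ≥0∞) (x : ℝ) :
    shift (volume.withDensity g) x = volume.withDensity fun t => g (t - x) := by
  ext s hs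
  have hm : Measurable fun y : ℝ => x + y := by fun_prop
  rw [shift, Measure.map_apply hm hs, withDensity_apply _ (hm hs), withDensity_apply _ hs,
    ← lintegral_indicator (hm hs), ← lintegral_indicator hs,
    ← lintegral_add_left_eq_self (s.indicator _) x]
  congr 1
  ext y
  by_cases h : x + y ∈ s
  · rw [Set.indicator_of_mem h, Set.indicator_of_mem (Set.mem_preimage.2 h), add_sub_cancel_left]
  · rw [Set.indicator_of_notMem h, Set.indicator_of_notMem (by exact h)]

lemma ennreal_smul_mono (c : ℝ≥0∞) {μ ν : Measure ℝ} (h : μ ≤ ν) : c • μ ≤ c • ν :=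
  Measure.le_iff.2 fun s _ => by
    simp only [Measure.smul_apply, smul_eq_mul]
    gcongr

lemma IsDiracUnimodalMixture.isProbabilityMeasure {μ : Measure ℝ}
    (hμ : IsDiracUnimodalMixture μ) : IsProbabilityMeasure μ := by
  obtain ⟨α, h0, h1, f, -, -, -, hf, rfl⟩ := hμ
  constructor
  simp only [Measure.add_apply, Measure.smul_apply, measure_univ, smul_eq_mul, mul_one,
    withDensity_apply _ MeasurableSet.univ, Measure.restrict_univ, hf]
  rw [← ENNReal.ofReal_add h0 (by linarith)]
  simp

/-- Two translates of a strictly unimodal law with a central atom cross once. -/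
lemma IsDiracUnimodalMixture.exists_singleCrossing {μ : Measure ℝ}
    (hμ : IsDiracUnimodalMixture μ) {x y : ℝ} (hxy : x < y) :
    ∃ A, SingleCrossing (shift μ x) (shift μ y) A := by
  obtain ⟨α, -, -, f, -, hmono, hanti, -, rfl⟩ := hμ
  -- Between the two modes one density decreases and the other increases, so they cross at most once
  -- there. The atom at `x` falls in `A` and the atom at `y` outside it, each on the side where its
  -- law dominates.
  set A : Set ℝ := {t | t ≤ x ∨ (t < y ∧ f (t - y) < f (t - x))} with hA
  have hlow : IsLowerSet A := by
    intro t t' htt ht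
    rcases le_or_gt t' x with h | h
    · exact Or.inl h
    rcases ht with ht | ⟨ht1, ht2⟩
    · exact absurd (htt.trans ht) (not_le.2 h)
    refine Or.inr ⟨htt.trans_lt ht1, ?_⟩
    have e1 := hmono.monotoneOn (Set.mem_Iio.2 (by linarith : t' - y < 0))
      (Set.mem_Iio.2 (by linarith : t - y < 0)) (by linarith)
    have e2 := hanti.antitoneOn (Set.mem_Ioi.2 (by linarith : 0 < t' - x))
      (Set.mem_Ioi.2 (by linarith : 0 < t - x)) (by linarith)
    linarith
  have hAm : MeasurableSet A := hlow.ordConnected.measurableSet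
  have hxA : x ∈ A := Or.inl le_rfl
  have hyA : y ∉ A := by
    rintro (h | h)
    · linarith
    · exact lt_irrefl _ h.1
  -- The value of `f` at its mode is unconstrained, so the two modes are discarded as null points.
  have hneq : ∀ᵐ t : ℝ, t ≠ x ∧ t ≠ y := by
    have h1 : ∀ c : ℝ, ∀ᵐ t : ℝ, t ≠ c := fun c => by simp [ae_iff, measure_singleton]
    exact (h1 x).and (h1 y)
  refine ⟨A, hlow, ?_, ?_⟩
  · rw [shift_add, shift_add, shift_smul, shift_smul, shift_smul, shift_smul, shift_dirac,
      shift_dirac, shift_withDensity, shift_withDensity]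
    simp only [Measure.restrict_add, Measure.restrict_smul, restrict_withDensity hAm, add_zero]
    rw [restrict_dirac' hAm, if_neg hyA, smul_zero, zero_add]
    refine le_trans ?_ (Measure.le_add_left le_rfl)
    refine ennreal_smul_mono _ ?_
    refine withDensity_mono ?_
    filter_upwards [ae_restrict_mem hAm, ae_restrict_of_ae hneq] with t ht hne
    refine ENNReal.ofReal_le_ofReal ?_
    rcases ht with ht | ht
    · have ht' : t < x := lt_of_le_of_ne ht hne.1
      exact hmono.monotoneOn (Set.mem_Iio.2 (by linarith)) (Set.mem_Iio.2 (by linarith))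
        (by linarith)
    · exact ht.2.le
  · rw [shift_add, shift_add, shift_smul, shift_smul, shift_smul, shift_smul, shift_dirac,
      shift_dirac, shift_withDensity, shift_withDensity]
    simp only [Measure.restrict_add, Measure.restrict_smul, restrict_withDensity hAm.compl,
      add_zero]
    rw [restrict_dirac' hAm.compl, if_neg (fun h => h hxA), smul_zero, zero_add]
    refine le_trans ?_ (Measure.le_add_left le_rfl)
    refine ennreal_smul_mono _ ?_
    refine withDensity_mono ?_
    filter_upwards [ae_restrict_mem hAm.compl, ae_restrict_of_ae hneq] with t ht hne
    refine ENNReal.ofReal_le_ofReal ?_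
    have htx : x < t := by
      by_contra h
      exact ht (Or.inl (not_lt.1 h))
    rcases lt_or_ge t y with hty | hty
    · by_contra! h
      exact ht (Or.inr ⟨hty, h⟩)
    · have hty' : y < t := lt_of_le_of_ne hty (Ne.symm hne.2)
      exact hanti.antitoneOn (Set.mem_Ioi.2 (by linarith)) (Set.mem_Ioi.2 (by linarith))
        (by linarith)

/-! ### Invariance of the one-step value -/

lemma IsCoupling.isProbabilityMeasure {π : Measure (ℝ × ℝ)} {μ₁ μ₂ : Measure ℝ}
    [IsProbabilityMeasure μ₁] (hπ : IsCoupling π μ₁ μ₂) : IsProbabilityMeasure π := by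
  constructor
  have := congrArg (fun m : Measure ℝ => m Set.univ) hπ.map_fst
  simpa [Measure.map_apply measurable_fst MeasurableSet.univ] using this

lemma IsCoupling.swap {π : Measure (ℝ × ℝ)} {μ₁ μ₂ : Measure ℝ} (hπ : IsCoupling π μ₁ μ₂) :
    IsCoupling (π.map Prod.swap) μ₂ μ₁ := by
  constructor
  · rw [Measure.map_map measurable_fst measurable_swap]; exact hπ.map_snd
  · rw [Measure.map_map measurable_snd measurable_swap]; exact hπ.map_fst

lemma payoff_swap {φ : ℝ → ℝ} (hφ : IsPayoff φ) (π : Measure (ℝ × ℝ)) :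
    payoff φ (π.map Prod.swap) = payoff φ π := by
  have hm : Measurable fun r : ℝ × ℝ => φ |r.1 - r.2| :=
    hφ.measurable_abs.comp (by fun_prop : Measurable fun r : ℝ × ℝ => r.1 - r.2)
  rw [payoff, integral_map measurable_swap.aemeasurable hm.aestronglyMeasurable, payoff]
  simp only [Prod.fst_swap, Prod.snd_swap, abs_sub_comm]

lemma payoff_amrLaw_comm {φ : ℝ → ℝ} (hφ : IsPayoff φ) (μ₁ μ₂ : Measure ℝ)
    [IsProbabilityMeasure μ₁] [IsProbabilityMeasure μ₂] :
    payoff φ (amrLaw μ₁ μ₂) = payoff φ (amrLaw μ₂ μ₁) := by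
  rw [amrLaw_swap μ₁ μ₂, payoff_swap hφ]

lemma payoff_amrLaw_self (φ : ℝ → ℝ) (μ : Measure ℝ) [IsProbabilityMeasure μ] :
    payoff φ (amrLaw μ μ) = φ 0 := by
  have hd : ∀ᵐ r ∂amrLaw μ μ, r.1 = r.2 := by
    rw [amrLaw, ae_map_iff (aemeasurable_amrMap μ μ)
      (measurableSet_eq_fun measurable_fst measurable_snd)]
    filter_upwards [ae_restrict_mem measurableSet_Ioo] with v hv
    have hq : amrMass μ μ ≤ v := by
      rw [amrMass, inf_idem, probReal_univ, sub_self]; exact hv.1.le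
    rw [amrMap_of_le μ μ hq]
  have : payoff φ (amrLaw μ μ) = ∫ _, φ 0 ∂amrLaw μ μ :=
    integral_congr_ae (hd.mono fun r hr => by simp only [hr, sub_self, abs_zero])
  rw [this]; simp

lemma payoff_le_zero {φ : ℝ → ℝ} (hφ : IsPayoff φ) (π : Measure (ℝ × ℝ)) [IsProbabilityMeasure π] :
    payoff φ π ≤ φ 0 := by
  have : payoff φ π ≤ ∫ _, φ 0 ∂π :=
    integral_mono (hφ.integrable_comp (by fun_prop)) (integrable_const _) fun r =>
      hφ.antitoneOn (Set.mem_Ici.2 le_rfl) (Set.mem_Ici.2 (abs_nonneg _)) (abs_nonneg _)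
  simpa using this

lemma abs_payoff_le {φ : ℝ → ℝ} {C : ℝ} (hC : ∀ x, 0 ≤ x → |φ x| ≤ C) (π : Measure (ℝ × ℝ))
    [IsProbabilityMeasure π] : |payoff φ π| ≤ C := by
  have := norm_integral_le_of_norm_le_const (μ := π) (f := fun r : ℝ × ℝ => φ |r.1 - r.2|)
    (Filter.Eventually.of_forall fun r => hC _ (abs_nonneg _))
  simpa [payoff] using this

section Walk

variable {μ : Measure ℝ} [IsProbabilityMeasure μ]

/-- One-step optimality of the AMR coupling, for arbitrary starting points. -/
theorem payoff_le_payoff_amrLaw (hμ : IsDiracUnimodalMixture μ) {x y : ℝ} {π : Measure (ℝ × ℝ)}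
    (hπ : IsCoupling π (shift μ x) (shift μ y)) {φ : ℝ → ℝ} (hφ : IsPayoff φ) :
    payoff φ π ≤ payoff φ (amrLaw (shift μ x) (shift μ y)) := by
  have := hπ.isProbabilityMeasure
  rcases lt_trichotomy x y with h | rfl | h
  · obtain ⟨A, hA⟩ := hμ.exists_singleCrossing h
    exact hA.payoff_le hπ hφ
  · rw [payoff_amrLaw_self]; exact payoff_le_zero hφ π
  · obtain ⟨A, hA⟩ := hμ.exists_singleCrossing h
    have := hπ.swap.isProbabilityMeasure
    rw [payoff_amrLaw_comm hφ, ← payoff_swap hφ π]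
    exact hA.payoff_le hπ.swap hφ

/-- The value of one AMR step started at distance `a`. -/
noncomputable def amrStep (μ : Measure ℝ) (φ : ℝ → ℝ) (a : ℝ) : ℝ :=
  payoff φ (amrLaw (shift μ 0) (shift μ a))

/-- A translated coupling is a coupling of the translated laws and has the same distances, so
optimality gives the bound. Translating back gives equality without computing the AMR law of the
translates. -/
lemma payoff_amrLaw_le_translate (hμ : IsDiracUnimodalMixture μ) {φ : ℝ → ℝ} (hφ : IsPayoff φ)
    (x y z : ℝ) : payoff φ (amrLaw (shift μ x) (shift μ y)) ≤
      payoff φ (amrLaw (shift μ (z + x)) (shift μ (z + y))) := by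
  have hm : Measurable fun r : ℝ × ℝ => (z + r.1, z + r.2) := by fun_prop
  have hc := isCoupling_amrLaw (shift μ x) (shift μ y)
  have hπ : IsCoupling ((amrLaw (shift μ x) (shift μ y)).map fun r => (z + r.1, z + r.2))
      (shift μ (z + x)) (shift μ (z + y)) := by
    constructor
    · rw [Measure.map_map measurable_fst hm, ← shift_map_add, ← hc.map_fst,
        Measure.map_map (by fun_prop) measurable_fst, hc.map_fst]
      rfl
    · rw [Measure.map_map measurable_snd hm, ← shift_map_add, ← hc.map_snd,
        Measure.map_map (by fun_prop) measurable_snd, hc.map_snd]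
      rfl
  refine le_trans (le_of_eq ?_) (payoff_le_payoff_amrLaw hμ hπ hφ)
  have hmφ : Measurable fun r : ℝ × ℝ => φ |r.1 - r.2| :=
    hφ.measurable_abs.comp (by fun_prop : Measurable fun r : ℝ × ℝ => r.1 - r.2)
  rw [payoff, payoff, integral_map hm.aemeasurable hmφ.aestronglyMeasurable]
  simp

/-- The value of one AMR step depends on the starting points only through their distance. -/
theorem payoff_amrLaw_eq (hμ : IsDiracUnimodalMixture μ) {φ : ℝ → ℝ} (hφ : IsPayoff φ) (x y : ℝ) :
    payoff φ (amrLaw (shift μ x) (shift μ y)) = amrStep μ φ |x - y| := by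
  have htr : ∀ x y, payoff φ (amrLaw (shift μ x) (shift μ y)) = amrStep μ φ (y - x) := by
    intro x y
    apply le_antisymm
    · have := payoff_amrLaw_le_translate hμ hφ x y (-x)
      rwa [neg_add_cancel, neg_add_eq_sub] at this
    · have := payoff_amrLaw_le_translate hμ hφ 0 (y - x) x
      rwa [add_zero, add_sub_cancel] at this
  rcases le_total x y with h | h
  · rw [htr, abs_of_nonpos (by linarith), neg_sub]
  · rw [payoff_amrLaw_comm hφ, htr, abs_of_nonneg (by linarith)]

/-! ### The one-step operator preserves the class of payoffs -/

/-- The increment is the length of the part of `[z, z + a]` in `[s, s + K]`. The reflection `t ↦ s +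
z - t` turns these into intervals of which the first is free of `z`, ready for Fubini. -/
lemma clamp_add_sub_clamp (s z : ℝ) {K a : ℝ} (hK : 0 ≤ K) (ha : 0 ≤ a) :
    clamp s K (a + z) - clamp s K z =
      volume.real (Set.Ioc (s - a) s ∩ Set.Ico (z - K) z) := by
  have hset : volume.real (Set.Ioc (s - a) s ∩ Set.Ico (z - K) z) =
      max (min s z - max (s - a) (z - K)) 0 := by
    have h1 : volume (Set.Ioc (s - a) s ∩ Set.Ico (z - K) z) =
        ENNReal.ofReal (min s z - max (s - a) (z - K)) := by
      rw [measure_congr ((Ioo_ae_eq_Ioc (μ := volume)).symm.inter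
        (Ioo_ae_eq_Ico (μ := volume)).symm), Set.Ioo_inter_Ioo, Real.volume_Ioo]
    rw [Measure.real, h1, ENNReal.toReal_ofReal']
  rw [hset]
  unfold clamp
  simp only [min_def, max_def]
  split_ifs <;> linarith

/-- The mass that `μ` puts on the window `(t - K, t]`. -/
noncomputable def window (μ : Measure ℝ) (K t : ℝ) : ℝ := μ.real (Set.Ioc (t - K) t)

/-- In this form the window mass is the unimodal difference attached to translates at distance `K`,
so `IsBump.exists_level` applies to it. -/
lemma window_eq {K : ℝ} (hK : 0 ≤ K) (t : ℝ) : window μ K t =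
    (shift μ 0).real (Set.Iic t) - (shift μ K).real (Set.Iic t) := by
  rw [measureReal_shift_Iic, measureReal_shift_Iic, sub_zero, window, ← Set.Iic_sdiff_Iic,
    measureReal_sdiff (Set.Iic_subset_Iic.2 (by linarith)) measurableSet_Iic]

lemma measurable_window {K : ℝ} (hK : 0 ≤ K) : Measurable (window μ K) := by
  have hmono : Monotone fun t => μ.real (Set.Iic t) := fun s t hst =>
    measureReal_mono (Set.Iic_subset_Iic.2 hst)
  have : window μ K = fun t => μ.real (Set.Iic t) - μ.real (Set.Iic (t - K)) := by
    ext t; rw [window_eq hK, measureReal_shift_Iic, measureReal_shift_Iic, sub_zero]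
  rw [this]
  exact hmono.measurable.sub (hmono.measurable.comp (by fun_prop : Measurable fun t : ℝ => t - K))

/-- Fubini exchanges the roles of `a` and `K`: the distance becomes the length of the integration
interval, and the hinge parameter the separation of the translates. -/
lemma integral_clamp_shift (s : ℝ) {K a : ℝ} (hK : 0 ≤ K) (ha : 0 ≤ a) :
    ∫ y, clamp s K y ∂shift μ a - ∫ x, clamp s K x ∂shift μ 0 =
      ∫ t in Set.Ioc (s - a) s, window μ K (t + K) := by
  have hm : ∀ x : ℝ, Measurable fun y : ℝ => x + y := fun x => by fun_prop
  have hi := integrable_clamp s hK μ (hm a)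
  have hi0 := integrable_clamp s hK μ (hm 0)
  rw [shift, shift, integral_map (hm a).aemeasurable (measurable_clamp s K).aestronglyMeasurable,
    integral_map (hm 0).aemeasurable (measurable_clamp s K).aestronglyMeasurable,
    ← integral_sub hi hi0]
  simp only [zero_add, clamp_add_sub_clamp s _ hK ha]
  set E : Set (ℝ × ℝ) := {q | q.1 < q.2 ∧ q.2 ≤ q.1 + K} with hE
  have hEm : MeasurableSet E :=
    (measurableSet_lt measurable_fst measurable_snd).inter
      (measurableSet_le measurable_snd (by fun_prop))
  have hint : Integrable (Function.uncurry fun t z => E.indicator (fun _ => (1 : ℝ)) (t, z))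
      ((volume.restrict (Set.Ioc (s - a) s)).prod μ) :=
    (integrable_const (1 : ℝ)).indicator hEm
  have hsw := integral_integral_swap hint
  have e1 : ∀ t, ∫ z, E.indicator (fun _ => (1 : ℝ)) (t, z) ∂μ = window μ K (t + K) := by
    intro t
    have : (fun z => E.indicator (fun _ => (1 : ℝ)) (t, z)) =
        (Set.Ioc t (t + K)).indicator fun _ => (1 : ℝ) := by
      ext z; simp [Set.indicator, hE]
    rw [this, integral_indicator_const _ measurableSet_Ioc, window, add_sub_cancel_right]
    simp
  have e2 : ∀ z, ∫ t in Set.Ioc (s - a) s, E.indicator (fun _ => (1 : ℝ)) (t, z) =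
      volume.real (Set.Ioc (s - a) s ∩ Set.Ico (z - K) z) := by
    intro z
    have : (fun t => E.indicator (fun _ => (1 : ℝ)) (t, z)) =
        (Set.Ico (z - K) z).indicator fun _ => (1 : ℝ) := by
      ext t
      simp only [Set.indicator, hE, Set.mem_ofPred_eq, Set.mem_Ico, and_comm, sub_le_iff_le_add]
    rw [this, integral_indicator_const _ measurableSet_Ico,
      measureReal_restrict_apply measurableSet_Ico, Set.inter_comm]
    simp
  simp only [e1, e2] at hsw
  exact hsw.symm

lemma amrStep_zero (φ : ℝ → ℝ) : amrStep μ φ 0 = φ 0 := payoff_amrLaw_self φ _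

lemma amrStep_hinge_le (s : ℝ) {K a : ℝ} (hK : 0 ≤ K) (ha : 0 ≤ a) :
    amrStep μ (hinge K) a ≤ K - ∫ t in Set.Ioc (s - a) s, window μ K (t + K) := by
  rw [← integral_clamp_shift s hK ha]
  exact (isCoupling_amrLaw _ _).payoff_hinge_le s hK

lemma exists_amrStep_hinge_eq (hμ : IsDiracUnimodalMixture μ) {K a : ℝ} (hK : 0 < K)
    (ha : 0 ≤ a) :
    ∃ s, amrStep μ (hinge K) a = K - ∫ t in Set.Ioc (s - a) s, window μ K (t + K) := by
  rcases ha.eq_or_lt with rfl | ha0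
  · refine ⟨0, ?_⟩
    rw [amrStep_zero]
    simp [hinge, hK.le]
  · obtain ⟨A, hA⟩ := hμ.exists_singleCrossing ha0
    obtain ⟨s, hs⟩ := hA.exists_payoff_hinge_eq hK
    exact ⟨s, by rw [← integral_clamp_shift s hK.le ha]; exact hs⟩

/-- Supporting lines of the one-step value of the payoff `(K - d)⁺`. -/
lemma exists_supporting_line (hμ : IsDiracUnimodalMixture μ) {K a : ℝ} (hK : 0 < K)
    (ha : 0 ≤ a) :
    ∃ u, 0 ≤ u ∧ ∀ a', 0 ≤ a' →
      amrStep μ (hinge K) a - u * (a' - a) ≤ amrStep μ (hinge K) a' := by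
  -- The crossing is that of translates at distance `K`, with a level interval of length `a`; the
  -- level `u` will be the negative of the slope of the supporting line.
  obtain ⟨A, hA⟩ := hμ.exists_singleCrossing hK
  obtain ⟨s₀, u, hu, hin, hout⟩ := hA.isBump.exists_level a
  simp only [← window_eq (μ := μ) hK.le] at hin hout
  refine ⟨u, hu, fun a' ha' => ?_⟩
  obtain ⟨s', hs'⟩ := exists_amrStep_hinge_eq hμ hK ha'
  -- With this choice, `t + K` runs over the level interval `(s₀, s₀ + a]`.
  have hle := amrStep_hinge_le (μ := μ) (s₀ + a - K) hK.le ha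
  rw [hs']
  have hbdd : ∀ t, |window μ K (t + K)| ≤ 1 := fun t => by
    rw [window, abs_of_nonneg measureReal_nonneg]; exact measureReal_le_one
  have hwm : Measurable fun t => window μ K (t + K) :=
    (measurable_window hK.le).comp (by fun_prop : Measurable fun t : ℝ => t + K)
  have hion : ∀ b c : ℝ, IntegrableOn (fun t => window μ K (t + K)) (Set.Ioc b c) := fun b c =>
    Measure.integrableOn_of_bounded (M := 1) (by simp) hwm.aestronglyMeasurable
      (Filter.Eventually.of_forall hbdd)
  have hic : ∀ b c : ℝ, IntegrableOn (fun _ => u) (Set.Ioc b c) := fun b c =>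
    integrableOn_const (by simp)
  have hval : ∀ s b : ℝ, 0 ≤ b → ∫ t in Set.Ioc (s - b) s, (window μ K (t + K) - u) =
      (∫ t in Set.Ioc (s - b) s, window μ K (t + K)) - u * b := fun s b hb => by
    rw [integral_sub (hion _ _) (hic _ _), setIntegral_const, Measure.real, Real.volume_Ioc,
      sub_sub_cancel, ENNReal.toReal_ofReal hb, smul_eq_mul, mul_comm]
  -- Bathtub principle: up to endpoints, the integrand is nonnegative on the level interval and
  -- nonpositive off it, so no interval of any length does better.
  have hcmp : ∫ t in Set.Ioc (s' - a') s', (window μ K (t + K) - u) ≤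
      ∫ t in Set.Ioc (s₀ + a - K - a) (s₀ + a - K), (window μ K (t + K) - u) := by
    rw [← integral_indicator measurableSet_Ioc, ← integral_indicator measurableSet_Ioc]
    refine integral_mono_ae (((hion _ _).sub (hic _ _)).integrable_indicator measurableSet_Ioc)
      (((hion _ _).sub (hic _ _)).integrable_indicator measurableSet_Ioc) ?_
    have h1 : ∀ c : ℝ, ∀ᵐ t : ℝ, t ≠ c := fun c => by simp [ae_iff, measure_singleton]
    filter_upwards [h1 (s₀ - K), h1 (s₀ + a - K)] with t ht1 ht2
    by_cases hI : t ∈ Set.Ioc (s₀ + a - K - a) (s₀ + a - K)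
    · rw [Set.indicator_of_mem hI]
      have h2 : t < s₀ + a - K := lt_of_le_of_ne hI.2 ht2
      have h3 : 0 ≤ window μ K (t + K) - u :=
        sub_nonneg.2 (hout _ ⟨by linarith [hI.1], by linarith⟩)
      exact Set.indicator_le_self' (fun _ _ => h3) t
    · rw [Set.indicator_of_notMem hI]
      refine Set.indicator_apply_nonpos fun _ => ?_
      by_contra! hpos
      have h2 := hin (t + K) (by linarith)
      exact hI ⟨lt_of_le_of_ne (by linarith [h2.1]) (fun h => ht1 (by linarith)),
        by linarith [h2.2]⟩
  rw [hval _ _ ha', hval _ _ ha] at hcmp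
  linarith

/-- The one-step value of a convex bounded nonincreasing payoff is again one. -/
theorem isPayoff_amrStep (hμ : IsDiracUnimodalMixture μ) {φ : ℝ → ℝ} (hφ : IsPayoff φ) :
    IsPayoff (amrStep μ φ) := by
  refine ⟨⟨convex_Ici 0, ?_⟩, ?_, ?_⟩
  · intro x hx y hy b c hb hc hbc
    rw [Set.mem_Ici] at hx hy
    set πx := amrLaw (shift μ 0) (shift μ x) with hπx
    set πy := amrLaw (shift μ 0) (shift μ y) with hπy
    -- Convexity becomes a comparison of two laws, the AMR law at the averaged distance and this
    -- mixture, so it suffices to check hinges, where supporting lines are available.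
    have hpr : IsProbabilityMeasure (ENNReal.ofReal b • πx + ENNReal.ofReal c • πy) := by
      constructor
      simp only [Measure.add_apply, Measure.smul_apply, measure_univ, smul_eq_mul, mul_one]
      rw [← ENNReal.ofReal_add hb hc, hbc, ENNReal.ofReal_one]
    have hlin : ∀ {ψ : ℝ → ℝ}, IsPayoff ψ →
        payoff ψ (ENNReal.ofReal b • πx + ENNReal.ofReal c • πy) =
          b * amrStep μ ψ x + c * amrStep μ ψ y := by
      intro ψ hψ
      have hix : Integrable (fun r : ℝ × ℝ => ψ |r.1 - r.2|) πx :=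
        hψ.integrable_comp (by fun_prop)
      have hiy : Integrable (fun r : ℝ × ℝ => ψ |r.1 - r.2|) πy :=
        hψ.integrable_comp (by fun_prop)
      rw [payoff, integral_add_measure (hix.smul_measure ENNReal.ofReal_ne_top)
        (hiy.smul_measure ENNReal.ofReal_ne_top), integral_smul_measure, integral_smul_measure,
        ENNReal.toReal_ofReal hb, ENNReal.toReal_ofReal hc]
      rfl
    simp only [smul_eq_mul]
    rw [← hlin hφ]
    refine payoff_le_of_hinge (fun K hK => ?_) hφ
    rw [hlin (isPayoff_hinge hK.le)]
    obtain ⟨u, -, hline⟩ := exists_supporting_line hμ hK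
      (add_nonneg (mul_nonneg hb hx) (mul_nonneg hc hy))
    have e1 := mul_le_mul_of_nonneg_left (hline x hx) hb
    have e2 := mul_le_mul_of_nonneg_left (hline y hy) hc
    change amrStep μ (hinge K) (b * x + c * y) ≤ _
    have hc' : c = 1 - b := by linarith
    subst hc'
    nlinarith
  · intro x hx y hy hxy
    refine payoff_le_of_hinge (fun K hK => ?_) hφ
    obtain ⟨u, hu, hline⟩ := exists_supporting_line hμ hK (Set.mem_Ici.1 hy)
    have := hline x hx
    change amrStep μ (hinge K) y ≤ amrStep μ (hinge K) x
    nlinarith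
  · obtain ⟨C, hC⟩ := hφ.bounded
    exact ⟨C, fun a _ => abs_payoff_le hC _⟩

end Walk

/-! ### Conditional laws -/

section CondLaw

variable {Ω : Type*} {m mΩ : MeasurableSpace Ω} {E : Type*} [MeasurableSpace E]

/-- `ν` is a version of the conditional law of `R` given `m`. -/
def IsCondLaw (P : Measure Ω) (m : MeasurableSpace Ω) (R : Ω → E) (ν : Ω → Measure E) : Prop :=
  ∀ B, MeasurableSet B → P⟦R ⁻¹' B | m⟧ =ᵐ[P] fun ω => (ν ω).real B

lemma IsCondLaw.map {E' : Type*} [MeasurableSpace E'] {P : Measure Ω} {R : Ω → E}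
    {ν : Ω → Measure E} (h : IsCondLaw P m R ν) {g : E → E'} (hg : Measurable g) :
    IsCondLaw P m (fun ω => g (R ω)) (fun ω => (ν ω).map g) := by
  intro B hB
  filter_upwards [h (g ⁻¹' B) (hg hB)] with ω hω
  rw [map_measureReal_apply hg hB, ← hω]
  rfl

lemma exists_isCondLaw [StandardBorelSpace E] [Nonempty E] (hm : m ≤ mΩ) (P : Measure Ω)
    [IsFiniteMeasure P] {R : Ω → E} (hR : Measurable R) :
    ∃ κ : Ω → Measure E, (∀ ω, IsProbabilityMeasure (κ ω)) ∧ IsCondLaw P m R κ ∧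
      ∀ f : E → ℝ, Measurable f → Integrable (fun ω => f (R ω)) P →
        P[fun ω => f (R ω) | m] =ᵐ[P] fun ω => ∫ r, f r ∂κ ω := by
  -- Conditioning on `m` is conditioning on the identity map into `Ω` equipped with `m`.
  have hid : @Measurable Ω Ω mΩ m id := fun s hs => hm s hs
  refine ⟨fun ω => @condDistrib Ω Ω E _ _ _ mΩ m R id P _ ω, fun ω => inferInstance, ?_, ?_⟩
  · intro B hB
    have := @condDistrib_ae_eq_condExp Ω Ω E _ _ _ mΩ P _ id R m B hid hR hB
    rw [MeasurableSpace.comap_id] at this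
    exact this.symm
  · intro f hf hfi
    have := @condExp_ae_eq_integral_condDistrib Ω Ω E ℝ _ _ _ _ mΩ P _ id R m _ _ hid
      hR.aemeasurable f hf.stronglyMeasurable hfi
    rw [MeasurableSpace.comap_id] at this
    exact this

/-- A countable generating algebra lets the exceptional null sets be united. No measurability of the
laws in `ω` is needed. -/
lemma IsCondLaw.ae_eq [MeasurableSpace.CountablyGenerated E] {P : Measure Ω} {R : Ω → E}
    {ν κ : Ω → Measure E} [∀ ω, IsProbabilityMeasure (ν ω)] [∀ ω, IsProbabilityMeasure (κ ω)]
    (hν : IsCondLaw P m R ν) (hκ : IsCondLaw P m R κ) : ∀ᵐ ω ∂P, ν ω = κ ω := by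
  set C := generateSetAlgebra (MeasurableSpace.countableGeneratingSet E) with hC
  have hCc : C.Countable :=
    countable_generateSetAlgebra MeasurableSpace.countable_countableGeneratingSet
  have hgen : ‹MeasurableSpace E› = MeasurableSpace.generateFrom C := by
    rw [hC, generateFrom_generateSetAlgebra_eq,
      MeasurableSpace.generateFrom_countableGeneratingSet]
  have hpi : IsPiSystem C := fun s hs t ht _ =>
    isSetAlgebra_generateSetAlgebra.inter_mem hs ht
  have hall : ∀ᵐ ω ∂P, ∀ B ∈ C, (ν ω).real B = (κ ω).real B := by
    rw [ae_ball_iff hCc]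
    intro B hB
    have hBm : MeasurableSet B := by
      rw [hgen]; exact MeasurableSpace.measurableSet_generateFrom hB
    filter_upwards [hν B hBm, hκ B hBm] with ω h1 h2
    rw [← h1, ← h2]
  filter_upwards [hall] with ω hω
  refine ext_of_generate_finite C hgen hpi (fun B hB => ?_) (by simp)
  exact (measureReal_eq_measureReal_iff).1 (hω B hB)

end CondLaw

/-! ### One step of the chains -/

section Step

variable {Ω : Type*} {m mΩ : MeasurableSpace Ω} {μ : Measure ℝ} [IsProbabilityMeasure μ]

/-- One-step bound: whatever the conditional coupling of two steps of the walk, the expected payoff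
is at most that of the AMR step. -/
lemma integral_payoff_le (hμ : IsDiracUnimodalMixture μ) (hm : m ≤ mΩ) {P : Measure Ω}
    [IsProbabilityMeasure P] {X Y X' Y' : Ω → ℝ} (hX : Measurable X) (hY : Measurable Y)
    (hX' : Measurable X') (hY' : Measurable Y')
    (hcX : IsCondLaw P m X' fun ω => shift μ (X ω))
    (hcY : IsCondLaw P m Y' fun ω => shift μ (Y ω)) {φ : ℝ → ℝ} (hφ : IsPayoff φ) :
    ∫ ω, φ |X' ω - Y' ω| ∂P ≤ ∫ ω, amrStep μ φ |X ω - Y ω| ∂P := by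
  obtain ⟨κ, hκp, hκ, hκi⟩ := exists_isCondLaw hm P (hX'.prodMk hY')
  have hfm : Measurable fun r : ℝ × ℝ => φ |r.1 - r.2| :=
    hφ.measurable_abs.comp (by fun_prop : Measurable fun r : ℝ × ℝ => r.1 - r.2)
  have hfi : Integrable (fun ω => φ |X' ω - Y' ω|) P :=
    hφ.integrable_comp (hX'.sub hY').aemeasurable
  have hce := hκi _ hfm hfi
  have hpr : ∀ (g : ℝ × ℝ → ℝ), Measurable g → ∀ ω, IsProbabilityMeasure ((κ ω).map g) :=
    fun g hg ω => Measure.isProbabilityMeasure_map hg.aemeasurable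
  have := hpr _ measurable_fst
  have := hpr _ measurable_snd
  have hfst := (hκ.map measurable_fst).ae_eq hcX
  have hsnd := (hκ.map measurable_snd).ae_eq hcY
  rw [← integral_condExp hm, integral_congr_ae hce]
  refine integral_mono_ae (integrable_condExp.congr hce)
    ((isPayoff_amrStep hμ hφ).integrable_comp (hX.sub hY).aemeasurable) ?_
  filter_upwards [hfst, hsnd] with ω h1 h2
  rw [← payoff_amrLaw_eq hμ hφ]
  exact payoff_le_payoff_amrLaw hμ ⟨h1, h2⟩ hφ

/-- The AMR step attains the one-step bound. -/
lemma integral_payoff_eq (hμ : IsDiracUnimodalMixture μ) (hm : m ≤ mΩ) {P : Measure Ω}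
    [IsProbabilityMeasure P] {X Y X' Y' : Ω → ℝ} (hX' : Measurable X') (hY' : Measurable Y')
    (hc : IsCondLaw P m (fun ω => (X' ω, Y' ω))
      fun ω => amrLaw (shift μ (X ω)) (shift μ (Y ω))) {φ : ℝ → ℝ} (hφ : IsPayoff φ) :
    ∫ ω, φ |X' ω - Y' ω| ∂P = ∫ ω, amrStep μ φ |X ω - Y ω| ∂P := by
  obtain ⟨κ, hκp, hκ, hκi⟩ := exists_isCondLaw hm P (hX'.prodMk hY')
  have hfm : Measurable fun r : ℝ × ℝ => φ |r.1 - r.2| :=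
    hφ.measurable_abs.comp (by fun_prop : Measurable fun r : ℝ × ℝ => r.1 - r.2)
  have hfi : Integrable (fun ω => φ |X' ω - Y' ω|) P :=
    hφ.integrable_comp (hX'.sub hY').aemeasurable
  have hce := hκi _ hfm hfi
  rw [← integral_condExp hm, integral_congr_ae hce]
  refine integral_congr_ae ?_
  filter_upwards [hκ.ae_eq hc] with ω h
  rw [h, ← payoff_amrLaw_eq hμ hφ, payoff]

end Step

/-! ### Immersion from conditional laws -/

section Immersion

variable {Ω : Type*}

lemma isPiSystem_inter (m₁ m₂ : MeasurableSpace Ω) :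
    IsPiSystem {D | ∃ D₁ D₂, MeasurableSet[m₁] D₁ ∧ MeasurableSet[m₂] D₂ ∧ D = D₁ ∩ D₂} := by
  rintro _ ⟨D₁, D₂, h1, h2, rfl⟩ _ ⟨D₁', D₂', h1', h2', rfl⟩ -
  exact ⟨D₁ ∩ D₁', D₂ ∩ D₂', MeasurableSet.inter h1 h1', MeasurableSet.inter h2 h2',
    Set.inter_inter_inter_comm _ _ _ _⟩

lemma sup_eq_generateFrom_inter (m₁ m₂ : MeasurableSpace Ω) : m₁ ⊔ m₂ =
    MeasurableSpace.generateFrom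
      {D | ∃ D₁ D₂, MeasurableSet[m₁] D₁ ∧ MeasurableSet[m₂] D₂ ∧ D = D₁ ∩ D₂} := by
  apply le_antisymm
  · refine sup_le (fun s hs => ?_) fun s hs => ?_
    · exact MeasurableSpace.measurableSet_generateFrom
        ⟨s, Set.univ, hs, MeasurableSet.univ, (Set.inter_univ s).symm⟩
    · exact MeasurableSpace.measurableSet_generateFrom
        ⟨Set.univ, s, MeasurableSet.univ, hs, (Set.univ_inter s).symm⟩
  · refine MeasurableSpace.generateFrom_le ?_
    rintro _ ⟨D₁, D₂, h1, h2, rfl⟩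
    exact MeasurableSet.inter ((le_sup_left : m₁ ≤ m₁ ⊔ m₂) _ h1)
      ((le_sup_right : m₂ ≤ m₁ ⊔ m₂) _ h2)

variable {m₁ m₂ mΩ : MeasurableSpace Ω} {E : Type*} [MeasurableSpace E] {P : Measure Ω}
  [IsProbabilityMeasure P] {U : Ω → E} {ν : Ω → Measure E}

/-- If the conditional law of `U` given `m₂` is `m₁`-measurable, then `U` brings no information on
the events of `m₂` beyond that of `m₁`. -/
lemma condExp_indicator_sup (h12 : m₁ ≤ m₂) (h2 : m₂ ≤ mΩ) (hU : Measurable U)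
    [∀ ω, IsProbabilityMeasure (ν ω)] (hν : IsCondLaw P m₂ U ν)
    (hνm : ∀ B, MeasurableSet B → StronglyMeasurable[m₁] fun ω => (ν ω).real B)
    {A : Set Ω} (hA : MeasurableSet[m₂] A) :
    P⟦A | m₁ ⊔ MeasurableSpace.comap U inferInstance⟧ =ᵐ[P] P⟦A | m₁⟧ := by
  have h1 : m₁ ≤ mΩ := h12.trans h2
  have hs : m₁ ⊔ MeasurableSpace.comap U inferInstance ≤ mΩ := sup_le h1 hU.comap_le
  have hα : Integrable (A.indicator fun _ => (1 : ℝ)) P :=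
    (integrable_const 1).indicator (h2 _ hA)
  have hg : Integrable (P⟦A | m₁⟧) P := integrable_condExp
  have hgm : StronglyMeasurable[m₁] (P⟦A | m₁⟧) := stronglyMeasurable_condExp
  symm
  refine ae_eq_condExp_of_forall_setIntegral_eq hs hα (fun _ _ _ => hg.integrableOn) ?_ ?_
  rotate_left
  · have hle : m₁ ≤ m₁ ⊔ MeasurableSpace.comap U inferInstance := le_sup_left
    have h3 := hgm.mono hle
    exact h3.aestronglyMeasurable
  intro D hD _
  induction D, hD using MeasurableSpace.induction_on_inter
    (sup_eq_generateFrom_inter m₁ (MeasurableSpace.comap U inferInstance))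
    (isPiSystem_inter m₁ _) with
  | empty => simp
  | basic D hD =>
    obtain ⟨D₁, _, hD₁, ⟨B, hB, rfl⟩, rfl⟩ := hD
    set β : Ω → ℝ := (U ⁻¹' B).indicator fun _ => (1 : ℝ) with hβ
    set α : Ω → ℝ := A.indicator fun _ => (1 : ℝ) with hαd
    set g : Ω → ℝ := P[α | m₁] with hgd
    set ρ : Ω → ℝ := fun ω => (ν ω).real B with hρ
    have hUB : MeasurableSet (U ⁻¹' B) := hU hB
    have hβi : Integrable β P := (integrable_const 1).indicator hUB
    have hmulβ : ∀ f : Ω → ℝ, f * β = (U ⁻¹' B).indicator f := fun f => by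
      ext ω; by_cases h : ω ∈ U ⁻¹' B <;> simp [hβ, h]
    have hρi : Integrable ρ P := Integrable.of_bound
      ((hνm B hB).mono h1).aestronglyMeasurable 1 (Filter.Eventually.of_forall fun ω => by
        rw [Real.norm_eq_abs, abs_of_nonneg measureReal_nonneg]; exact measureReal_le_one)
    have hαρ : Integrable (α * ρ) P := by
      have : α * ρ = A.indicator ρ := by
        ext ω; by_cases h : ω ∈ A <;> simp [hαd, h]
      rw [this]; exact hρi.indicator (h2 _ hA)
    have e2 : P[β | m₂] =ᵐ[P] ρ := hν B hB
    have e1 : P[β | m₁] =ᵐ[P] ρ := by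
      refine (condExp_condExp_of_le h12 h2).symm.trans ((condExp_congr_ae e2).trans ?_)
      rw [condExp_of_stronglyMeasurable h1 (hνm B hB) hρi]
    -- Both `g * β` and `α * β` have `m₁`-conditional expectation `g * ρ`. For the first, `g` is
    -- pulled out; for the second, conditioning passes through `m₂`, where `α` is measurable.
    have e3 : P[g * β | m₁] =ᵐ[P] g * ρ := by
      refine (condExp_mul_of_stronglyMeasurable_left stronglyMeasurable_condExp ?_ hβi).trans ?_
      · rw [hmulβ]; exact hg.indicator hUB
      · exact e1.mono fun ω hω => by simp only [Pi.mul_apply, hω]; rfl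
    have hαβ : Integrable (α * β) P := by rw [hmulβ]; exact hα.indicator hUB
    have e4 : P[α * β | m₁] =ᵐ[P] g * ρ := by
      refine (condExp_condExp_of_le h12 h2).symm.trans ?_
      have hα2 : StronglyMeasurable[m₂] α := stronglyMeasurable_const.indicator hA
      have e5 : P[α * β | m₂] =ᵐ[P] α * ρ :=
        (condExp_mul_of_stronglyMeasurable_left hα2 hαβ hβi).trans
          (e2.mono fun ω hω => by simp only [Pi.mul_apply, hω])
      exact (condExp_congr_ae e5).trans
        (condExp_mul_of_stronglyMeasurable_right (hνm B hB) hαρ hα)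
    rw [← setIntegral_indicator hUB, ← setIntegral_indicator hUB, ← hmulβ, ← hmulβ,
      ← setIntegral_condExp h1 (by rw [hmulβ]; exact hg.indicator hUB) hD₁,
      ← setIntegral_condExp h1 hαβ hD₁]
    exact integral_congr_ae (ae_restrict_of_ae (e3.trans e4.symm))
  | compl D hD ih =>
    have e1 := integral_add_compl (hs _ hD) hg
    have e2 := integral_add_compl (hs _ hD) hα
    have e3 := integral_condExp (μ := P) (f := A.indicator fun _ => (1 : ℝ)) h1
    linarith [ih (measure_lt_top _ _)]
  | iUnion D hdisj hD ih =>
    rw [integral_iUnion (fun i => hs _ (hD i)) hdisj hg.integrableOn,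
      integral_iUnion (fun i => hs _ (hD i)) hdisj hα.integrableOn]
    exact tsum_congr fun i => ih i (measure_lt_top _ _)

/-- If the conditional law of `U` given `m₂` is `m₁`-measurable, then conditioning a functional of
`m₁` and `U` on `m₂` is the same as conditioning it on `m₁`. -/
lemma condExp_eq_condExp_of_isCondLaw (h12 : m₁ ≤ m₂) (h2 : m₂ ≤ mΩ) (hU : Measurable U)
    [∀ ω, IsProbabilityMeasure (ν ω)] (hν : IsCondLaw P m₂ U ν)
    (hνm : ∀ B, MeasurableSet B → StronglyMeasurable[m₁] fun ω => (ν ω).real B)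
    {f : Ω → ℝ} (hf : StronglyMeasurable[m₁ ⊔ MeasurableSpace.comap U inferInstance] f)
    (hfi : Integrable f P) : P[f | m₂] =ᵐ[P] P[f | m₁] := by
  have h1 : m₁ ≤ mΩ := h12.trans h2
  have hs : m₁ ⊔ MeasurableSpace.comap U inferInstance ≤ mΩ := sup_le h1 hU.comap_le
  symm
  refine ae_eq_condExp_of_forall_setIntegral_eq h2 hfi
    (fun _ _ _ => integrable_condExp.integrableOn) ?_
    ((stronglyMeasurable_condExp.mono h12).aestronglyMeasurable)
  intro A hA _
  set α : Ω → ℝ := A.indicator fun _ => (1 : ℝ) with hαd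
  set h : Ω → ℝ := P[f | m₁] with hh
  have hmulα : ∀ k : Ω → ℝ, α * k = A.indicator k := fun k => by
    ext ω; by_cases hω : ω ∈ A <;> simp [hαd, hω]
  have hα : Integrable α P := (integrable_const 1).indicator (h2 _ hA)
  have hhi : Integrable h P := integrable_condExp
  have hgb : ∀ᵐ ω ∂P, ‖(P[α | m₁]) ω‖ ≤ (1 : ℝ) := by
    exact ae_bdd_abs_condExp_of_ae_bdd_abs (Filter.Eventually.of_forall fun ω => by
      by_cases hω : ω ∈ A <;> simp [hαd, hω])
  have hαf : Integrable (α * f) P := by rw [hmulα]; exact hfi.indicator (h2 _ hA)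
  have hαh : Integrable (α * h) P := by rw [hmulα]; exact hhi.indicator (h2 _ hA)
  have hgf : Integrable (P[α | m₁] * f) P :=
    hfi.bdd_mul integrable_condExp.aestronglyMeasurable hgb
  rw [← integral_indicator (h2 _ hA), ← integral_indicator (h2 _ hA), ← hmulα, ← hmulα]
  -- By self-adjointness the conditioning moves from `f` to `α`; it may then be refined by `U`,
  -- after which `f` is measurable and the conditioning disappears.
  calc ∫ ω, (α * h) ω ∂P = ∫ ω, (P[α * h | m₁]) ω ∂P := (integral_condExp h1).symm
    _ = ∫ ω, (P[α | m₁] * h) ω ∂P := integral_congr_ae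
        (condExp_mul_of_stronglyMeasurable_right stronglyMeasurable_condExp hαh hα)
    _ = ∫ ω, (P[P[α | m₁] * f | m₁]) ω ∂P := integral_congr_ae
        (condExp_mul_of_stronglyMeasurable_left stronglyMeasurable_condExp hgf hfi).symm
    _ = ∫ ω, (P[α | m₁] * f) ω ∂P := integral_condExp h1
    _ = ∫ ω, (P[α | m₁ ⊔ MeasurableSpace.comap U inferInstance] * f) ω ∂P := integral_congr_ae
        ((condExp_indicator_sup h12 h2 hU hν hνm hA).symm.mono fun ω hω => by
          simp only [Pi.mul_apply]; rw [hω])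
    _ = ∫ ω, (P[α * f | m₁ ⊔ MeasurableSpace.comap U inferInstance]) ω ∂P := integral_congr_ae
        (condExp_mul_of_stronglyMeasurable_right hf hαf hα).symm
    _ = ∫ ω, (α * f) ω ∂P := integral_condExp hs

end Immersion

/-! ### Immersion couplings of two walks -/

section Chain

variable {Ω : Type u} {mΩ : MeasurableSpace Ω} {l : ℕ} {P : Measure Ω} [IsProbabilityMeasure P]
  {p : Kernel ℝ ℝ}

/-- In an immersion coupling, each chain moves according to its kernel also relative to the common
filtration. -/
lemma IsMarkovChain.isCondLaw {ℱ : Filtration (Set.Ici l) mΩ} {U : Set.Ici l → Ω → ℝ}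
    (hU : IsMarkovChain p P U)
    (himm : ∀ M : Set.Ici l → Ω → ℝ,
      Martingale M (Filtration.natural U (fun k => (hU.measurable k).stronglyMeasurable)) P →
        Martingale M ℱ P) (k : ℕ) (hk : l ≤ k) :
    IsCondLaw P (ℱ ⟨k, hk⟩) (U ⟨k + 1, Nat.le_succ_of_le hk⟩) fun ω => p (U ⟨k, hk⟩ ω) := by
  intro B hB
  set G := Filtration.natural U (fun k => (hU.measurable k).stronglyMeasurable) with hG
  set k₀ : Set.Ici l := ⟨k, hk⟩ with hk₀
  set k₁ : Set.Ici l := ⟨k + 1, Nat.le_succ_of_le hk⟩ with hk₁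
  have hle : k₀ ≤ k₁ := Subtype.mk_le_mk.2 (Nat.le_succ k)
  -- The test martingale closed by the event that the next position lies in `B`: at time `k + 1` it
  -- is the indicator, and at time `k` the kernel value.
  have hM := himm _ (martingale_condExp ((U k₁ ⁻¹' B).indicator fun _ => (1 : ℝ)) G P)
  have hmeas : MeasurableSet[G k₁] (U k₁ ⁻¹' B) :=
    (Filtration.stronglyAdapted_natural
      (fun k => (hU.measurable k).stronglyMeasurable) k₁).measurable hB
  have hend : P⟦U k₁ ⁻¹' B | G k₁⟧ = (U k₁ ⁻¹' B).indicator fun _ => (1 : ℝ) :=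
    condExp_of_stronglyMeasurable (G.le k₁) (stronglyMeasurable_const.indicator hmeas)
      ((integrable_const 1).indicator (hU.measurable k₁ hB))
  have h1 := hM.2 k₀ k₁ hle
  beta_reduce at h1
  rw [hend] at h1
  exact h1.trans (hU.transition k hk B hB)

variable {μ : Measure ℝ} [IsProbabilityMeasure μ] {X Y : Set.Ici l → Ω → ℝ}

/-- The expected payoff at time `k` of two walks moving relative to a common filtration is bounded
by the iterated AMR step. -/
lemma integral_le_iterate (hμ : IsDiracUnimodalMixture μ) {ℱ : Filtration (Set.Ici l) mΩ}
    (hX : ∀ k, Measurable (X k)) (hY : ∀ k, Measurable (Y k))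
    (hcX : ∀ k hk, IsCondLaw P (ℱ ⟨k, hk⟩) (X ⟨k + 1, Nat.le_succ_of_le hk⟩)
      fun ω => shift μ (X ⟨k, hk⟩ ω))
    (hcY : ∀ k hk, IsCondLaw P (ℱ ⟨k, hk⟩) (Y ⟨k + 1, Nat.le_succ_of_le hk⟩)
      fun ω => shift μ (Y ⟨k, hk⟩ ω))
    {a : ℝ} (h0 : ∀ᵐ ω ∂P, |X ⟨l, le_refl l⟩ ω - Y ⟨l, le_refl l⟩ ω| = a) (k : ℕ) (hk : l ≤ k) :
    ∀ φ, IsPayoff φ →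
      ∫ ω, φ |X ⟨k, hk⟩ ω - Y ⟨k, hk⟩ ω| ∂P ≤ (amrStep μ)^[k - l] φ a := by
  induction k, hk using Nat.le_induction with
  | base =>
    intro φ _
    rw [integral_congr_ae (h0.mono fun ω hω => by simp only [hω] :
      (fun ω => φ |X ⟨l, le_refl l⟩ ω - Y ⟨l, le_refl l⟩ ω|) =ᵐ[P] fun _ => φ a)]
    simp
  | succ k hk ih =>
    intro φ hφ
    -- The last step of the chain is the first application of `amrStep`. The payoff thus changes
    -- along the induction, so all payoffs are treated at once.
    rw [Nat.succ_sub hk, Function.iterate_succ_apply]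
    exact (integral_payoff_le hμ (ℱ.le _) (hX _) (hY _) (hX _) (hY _) (hcX k hk) (hcY k hk)
      hφ).trans (ih _ (isPayoff_amrStep hμ hφ))

/-- For a chain moving by AMR steps the bound is attained. -/
lemma integral_eq_iterate (hμ : IsDiracUnimodalMixture μ) {ℱ : Filtration (Set.Ici l) mΩ}
    (hX : ∀ k, Measurable (X k)) (hY : ∀ k, Measurable (Y k))
    (hc : ∀ k hk, IsCondLaw P (ℱ ⟨k, hk⟩)
      (fun ω => (X ⟨k + 1, Nat.le_succ_of_le hk⟩ ω, Y ⟨k + 1, Nat.le_succ_of_le hk⟩ ω))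
      fun ω => amrLaw (shift μ (X ⟨k, hk⟩ ω)) (shift μ (Y ⟨k, hk⟩ ω)))
    {a : ℝ} (h0 : ∀ᵐ ω ∂P, |X ⟨l, le_refl l⟩ ω - Y ⟨l, le_refl l⟩ ω| = a) (k : ℕ) (hk : l ≤ k) :
    ∀ φ, IsPayoff φ →
      ∫ ω, φ |X ⟨k, hk⟩ ω - Y ⟨k, hk⟩ ω| ∂P = (amrStep μ)^[k - l] φ a := by
  induction k, hk using Nat.le_induction with
  | base =>
    intro φ _
    rw [integral_congr_ae (h0.mono fun ω hω => by simp only [hω] :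
      (fun ω => φ |X ⟨l, le_refl l⟩ ω - Y ⟨l, le_refl l⟩ ω|) =ᵐ[P] fun _ => φ a)]
    simp
  | succ k hk ih =>
    intro φ hφ
    rw [Nat.succ_sub hk, Function.iterate_succ_apply]
    exact (integral_payoff_eq hμ (ℱ.le _) (hX _) (hY _) (hc k hk) hφ).trans
      (ih _ (isPayoff_amrStep hμ hφ))

/-! ### The augmented filtration of an AMR chain -/

/-- The filtration obtained by adding all null events. -/
def augment (P : Measure Ω) (F : Filtration (Set.Ici l) mΩ) : Filtration (Set.Ici l) mΩ where
  -- `P` need not be complete, so the completion is cut back to the ambient σ-algebra.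
  seq i := eventuallyMeasurableSpace (F i) (ae P) ⊓ mΩ
  mono' _ _ hij := inf_le_inf_right _ fun _ ⟨t, ht, hst⟩ => ⟨t, F.mono hij _ ht, hst⟩
  le' _ := inf_le_right

omit [IsProbabilityMeasure P] in
lemma measurableSet_augment {F : Filtration (Set.Ici l) mΩ} {k : Set.Ici l} {s : Set Ω} :
    MeasurableSet[augment P F k] s ↔
      (∃ t, MeasurableSet[F k] t ∧ s =ᵐ[P] t) ∧ MeasurableSet s :=
  MeasurableSpace.measurableSet_inf

omit [IsProbabilityMeasure P] in
lemma le_augment (F : Filtration (Set.Ici l) mΩ) (k : Set.Ici l) : F k ≤ augment P F k :=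
  fun s hs => measurableSet_augment.2 ⟨⟨s, hs, Filter.EventuallyEq.rfl⟩, F.le k _ hs⟩

lemma condExp_augment (F : Filtration (Set.Ici l) mΩ) (k : Set.Ici l) {f : Ω → ℝ}
    (hf : Integrable f P) : P[f | augment P F k] =ᵐ[P] P[f | F k] := by
  have hm : StronglyMeasurable[F k] (P[f | F k]) := stronglyMeasurable_condExp
  have hm' := hm.mono (le_augment (P := P) F k)
  symm
  refine ae_eq_condExp_of_forall_setIntegral_eq ((augment P F).le k) hf
    (fun _ _ _ => integrable_condExp.integrableOn) (fun s hs _ => ?_) hm'.aestronglyMeasurable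
  obtain ⟨⟨t, ht, hst⟩, -⟩ := measurableSet_augment.1 hs
  rw [setIntegral_congr_set hst, setIntegral_congr_set hst, setIntegral_condExp (F.le k) hf ht]

variable {ℱ : Filtration (Set.Ici l) mΩ} {U : Set.Ici l → Ω → ℝ}

lemma natural_le (hU : ∀ k, Measurable (U k)) (had : StronglyAdapted ℱ U) (k : Set.Ici l) :
    Filtration.natural U (fun k => (hU k).stronglyMeasurable) k ≤ ℱ k := by
  refine iSup₂_le fun j hj => ?_
  rw [← measurable_iff_comap_le]
  exact ((had j).measurable).mono (ℱ.mono hj) le_rfl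

lemma stronglyMeasurable_kernel {m : MeasurableSpace Ω} {V : Ω → ℝ} (hV : Measurable[m] V)
    {B : Set ℝ} (hB : MeasurableSet B) : StronglyMeasurable[m] fun ω => (p (V ω)).real B :=
  (((p.measurable_coe hB).comp hV).ennreal_toReal).stronglyMeasurable

lemma measurable_natural (hU : ∀ k, Measurable (U k)) (k : Set.Ici l) :
    Measurable[Filtration.natural U (fun k => (hU k).stronglyMeasurable) k] (U k) :=
  (Filtration.stronglyAdapted_natural (fun k => (hU k).stronglyMeasurable) k).measurable

/-- A process that moves according to a kernel relative to some filtration is a Markov chain. -/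
lemma isMarkovChain_of_isCondLaw [IsMarkovKernel p] (hU : ∀ k, Measurable (U k))
    (had : StronglyAdapted ℱ U)
    (hc : ∀ k hk, IsCondLaw P (ℱ ⟨k, hk⟩) (U ⟨k + 1, Nat.le_succ_of_le hk⟩)
      fun ω => p (U ⟨k, hk⟩ ω)) : IsMarkovChain p P U := by
  refine ⟨hU, fun k hk B hB => ?_⟩
  have hsm := stronglyMeasurable_kernel (p := p) (measurable_natural hU ⟨k, hk⟩) hB
  refine (condExp_condExp_of_le (natural_le hU had ⟨k, hk⟩) (ℱ.le _)).symm.trans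
    ((condExp_congr_ae (hc k hk B hB)).trans ?_)
  rw [condExp_of_stronglyMeasurable (Filtration.le _ _) hsm]
  exact Integrable.of_bound (hsm.mono (Filtration.le _ _)).aestronglyMeasurable 1
    (Filter.Eventually.of_forall fun ω => by
      rw [Real.norm_eq_abs, abs_of_nonneg measureReal_nonneg]; exact measureReal_le_one)

/-- A process that moves according to a kernel relative to a filtration is immersed in it. -/
lemma martingale_of_isCondLaw [IsMarkovKernel p] (hU : ∀ k, Measurable (U k))
    (had : StronglyAdapted ℱ U)
    (hc : ∀ k hk, IsCondLaw P (ℱ ⟨k, hk⟩) (U ⟨k + 1, Nat.le_succ_of_le hk⟩)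
      fun ω => p (U ⟨k, hk⟩ ω)) {M : Set.Ici l → Ω → ℝ}
    (hM : Martingale M (Filtration.natural U (fun k => (hU k).stronglyMeasurable)) P) :
    Martingale M ℱ P := by
  set G := Filtration.natural U (fun k => (hU k).stronglyMeasurable) with hG
  refine ⟨fun k => (hM.1 k).mono (natural_le hU had k), ?_⟩
  have hstep : ∀ k (hk : l ≤ k),
      P[M ⟨k + 1, Nat.le_succ_of_le hk⟩ | ℱ ⟨k, hk⟩] =ᵐ[P] M ⟨k, hk⟩ := by
    intro k hk
    have hle : (⟨k, hk⟩ : Set.Ici l) ≤ ⟨k + 1, Nat.le_succ_of_le hk⟩ :=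
      Subtype.mk_le_mk.2 (Nat.le_succ k)
    -- The only new information in the natural filtration is the next position, whose law given the
    -- large σ-algebra is already measurable for the small one.
    have hsup : G ⟨k + 1, Nat.le_succ_of_le hk⟩ ≤ G ⟨k, hk⟩ ⊔
        MeasurableSpace.comap (U ⟨k + 1, Nat.le_succ_of_le hk⟩) inferInstance := by
      refine iSup₂_le fun j hj => ?_
      rcases (Nat.le_succ_iff.1 (Subtype.mk_le_mk.1 hj) : j.1 ≤ k ∨ j.1 = k + 1) with h | h
      · refine le_trans ?_ le_sup_left
        rw [← measurable_iff_comap_le]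
        exact (measurable_natural hU j).mono (G.mono (Subtype.mk_le_mk.2 h)) le_rfl
      · have : j = ⟨k + 1, Nat.le_succ_of_le hk⟩ := Subtype.ext h
        rw [this]
        exact le_sup_right
    refine (condExp_eq_condExp_of_isCondLaw (natural_le hU had ⟨k, hk⟩) (ℱ.le _) (hU _) (hc k hk)
      (fun B hB => stronglyMeasurable_kernel (measurable_natural hU ⟨k, hk⟩) hB)
      ((hM.1 _).mono hsup) (hM.integrable _)).trans (hM.2 _ _ hle)
  rintro ⟨i, hi⟩ ⟨j, hj⟩ hij
  have hij' : i ≤ j := hij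
  clear hij
  induction j, hij' using Nat.le_induction with
  | base =>
    rw [condExp_of_stronglyMeasurable (ℱ.le _) ((hM.1 _).mono (natural_le hU had _))
      (hM.integrable _)]
  | succ j hij ih =>
    have hlj : l ≤ j := hi.trans hij
    exact (condExp_condExp_of_le (ℱ.mono (Subtype.mk_le_mk.2 hij)) (ℱ.le ⟨j, hlj⟩)).symm.trans
      ((condExp_congr_ae (hstep j hlj)).trans (ih hlj))

end Chain

end AMRWalk

/-! ### Optimality of the AMR chain among immersion couplings. -/

theorem theorem2p3 {Ω : Type u} [MeasurableSpace Ω] (P : Measure Ω) [IsProbabilityMeasure P]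
    (p : Kernel ℝ ℝ) (hp : AMRWalk.IsUnimodalWalkKernel p)
    (X : ℕ → Ω → ℝ) (hX : AMRWalk.IsMarkovChain p P (fun k : Set.Ici 0 => X k))
    (l : ℕ) (a : ℝ) (ha : 0 < a)
    (Z : Set.Ici l → Ω → ℝ)
    (hstart : ∀ᵐ ω ∂P, |Z ⟨l, le_refl l⟩ ω - X l ω| = a)
    (hZ : AMRWalk.IsMarkovChain (fun q : ℝ × ℝ => AMRWalk.amrLaw (p q.1) (p q.2)) P
      (fun (k : Set.Ici l) ω => (X k ω, Z k ω)))
    (φ : ℝ → ℝ) (hconv : ConvexOn ℝ (Set.Ici 0) φ) (hcont : ContinuousOn φ (Set.Ici 0))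
    (hanti : AntitoneOn φ (Set.Ici 0)) (hbdd : ∃ C, ∀ x, 0 ≤ x → |φ x| ≤ C)
    (n : ℕ) (hln : l < n) :
    AMRWalk.psi.{u} p φ hln.le a = ∫ ω, φ |X n ω - Z ⟨n, hln.le⟩ ω| ∂P ∧
      IsGreatest (AMRWalk.immersionPayoffs.{u} p φ hln.le a)
        (∫ ω, φ |X n ω - Z ⟨n, hln.le⟩ ω| ∂P) := by
  open AMRWalk in
  obtain ⟨μ, hμ, hpμ⟩ := hp
  have hμp := hμ.isProbabilityMeasure
  have hps : ∀ x, p x = shift μ x := hpμ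
  have hpm : IsMarkovKernel p := ⟨fun x => by rw [hps]; infer_instance⟩
  have hφ : IsPayoff φ := ⟨hconv, hanti, hbdd⟩
  have h0 : ∀ᵐ ω ∂P, |X l ω - Z ⟨l, le_refl l⟩ ω| = a :=
    hstart.mono fun ω hω => by rw [abs_sub_comm]; exact hω
  set X' : Set.Ici l → Ω → ℝ := fun k => X k with hX'
  have hXm : ∀ k, Measurable (X' k) := fun k => measurable_fst.comp (hZ.measurable k)
  have hZm : ∀ k, Measurable (Z k) := fun k => measurable_snd.comp (hZ.measurable k)
  set F := Filtration.natural (fun (k : Set.Ici l) ω => (X k ω, Z k ω))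
    (fun j => (hZ.measurable j).stronglyMeasurable) with hF
  have hFm : ∀ k, Measurable[F k] fun ω => (X k ω, Z k ω) := fun k =>
    (Filtration.stronglyAdapted_natural
      (fun j => (hZ.measurable j).stronglyMeasurable) k).measurable
  have hjoint : ∀ k (hk : l ≤ k), IsCondLaw P (augment P F ⟨k, hk⟩)
      (fun ω => (X' ⟨k + 1, Nat.le_succ_of_le hk⟩ ω, Z ⟨k + 1, Nat.le_succ_of_le hk⟩ ω))
      fun ω => amrLaw (shift μ (X' ⟨k, hk⟩ ω)) (shift μ (Z ⟨k, hk⟩ ω)) := by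
    intro k hk B hB
    refine (condExp_augment F ⟨k, hk⟩
      ((integrable_const 1).indicator (hZ.measurable _ hB))).trans ?_
    simp only [← hps]
    exact hZ.transition k hk B hB
  have hcX : ∀ k hk, IsCondLaw P (augment P F ⟨k, hk⟩) (X' ⟨k + 1, Nat.le_succ_of_le hk⟩)
      fun ω => p (X' ⟨k, hk⟩ ω) := fun k hk => by
    have := (hjoint k hk).map measurable_fst
    simpa only [amrLaw_map_fst, ← hps] using this
  have hcZ : ∀ k hk, IsCondLaw P (augment P F ⟨k, hk⟩) (Z ⟨k + 1, Nat.le_succ_of_le hk⟩)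
      fun ω => p (Z ⟨k, hk⟩ ω) := fun k hk => by
    have := (hjoint k hk).map measurable_snd
    simpa only [amrLaw_map_snd, ← hps] using this
  have haX : StronglyAdapted (augment P F) X' := fun k =>
    ((measurable_fst.comp (hFm k)).mono (le_augment F k) le_rfl).stronglyMeasurable
  have haZ : StronglyAdapted (augment P F) Z := fun k =>
    ((measurable_snd.comp (hFm k)).mono (le_augment F k) le_rfl).stronglyMeasurable
  have hval := integral_eq_iterate hμ hXm hZm hjoint h0 n hln.le φ hφ
  have hgreatest : IsGreatest (immersionPayoffs.{u} p φ hln.le a)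
      (∫ ω, φ |X n ω - Z ⟨n, hln.le⟩ ω| ∂P) := by
    -- Attainment: the given AMR chain, with the natural filtration of the pair augmented by null
    -- events, is an admissible competitor. Each coordinate keeps its kernel there because the AMR
    -- law has the right marginals.
    refine ⟨⟨Ω, inferInstance, P, inferInstance, augment P F, X', Z,
      isMarkovChain_of_isCondLaw hXm haX hcX, isMarkovChain_of_isCondLaw hZm haZ hcZ,
      ⟨hXm, hZm, ?_, haX, haZ, fun M hM => martingale_of_isCondLaw hXm haX hcX hM,
        fun M hM => martingale_of_isCondLaw hZm haZ hcZ hM⟩, h0, rfl⟩, ?_⟩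
    · exact fun k s hs hs0 => measurableSet_augment.2
        ⟨⟨∅, @MeasurableSet.empty _ (F k), ae_eq_empty.2 hs0⟩, hs⟩
    · rintro _ ⟨Ω', mΩ', P', hP', ℱ, V, W, hV, hW, himm, h0', rfl⟩
      refine le_trans ?_ hval.ge
      refine integral_le_iterate (ℱ := ℱ) hμ himm.measurable_left himm.measurable_right
        (fun k hk => ?_) (fun k hk => ?_) h0' n hln.le φ hφ
      · simp only [← hps]
        exact hV.isCondLaw himm.martingale_left k hk
      · simp only [← hps]
        exact hW.isCondLaw himm.martingale_right k hk
  exact ⟨hgreatest.csSup_eq, hgreatest⟩
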